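/- **Setting.** Let $E$ be a measurable space, $\Pi$ a Markov kernel on $E$, $\alpha\in(0,1)$, and $f_i,g_i,h_i:E\to\mathbb R$ ($i=1,2$) measurable. On a measurable space $\Omega$ with probability measures $(\mathbb P_x)_{x\in E}$ let $X=(X_n)_{n\ge 0}$ be, under each $\mathbb P_x$, a time-homogeneous Markov process with kernel $\Pi$ and $X_0=x$, and let $(\xi^{(i)}_n)_{n\ge0}$, $i=1,2$, be two families of random variables uniform on $(0,1)$ such that all the $\xi^{(i)}_n$ are mutually independent and jointly independent of $X$. Let $\tilde X$ be $X$ killed at each time $n\ge1$ with probability $1-\alpha$, independently of $X$, i.e. $\tilde X_n=X_n$ if $n\le T$ and $\tilde X_n=K$ otherwise, where $K$ is a cemetery state at which all functions are $0$ and $T$ is independent of $X$ with $\mathbb P_x(T\ge n)=\alpha^n$ for all $n\ge0$. Assume that for every $x\in E$ and $i=1,2$ the suprema over $n\ge 0$ of $|f_i(\tilde X_n)|$, $|g_i(\tilde X_n)|$ and $|h_i(\tilde X_n)|$ are in $L^1(\mathbb P_x)$. An admissible stopping time of player $i$ is a $\{0,1,\dots,\infty\}$-valued stopping time of the filtration $\sigma(X_0,\dots,X_n,\xi^{(i)}_0,\dots,\xi^{(i)}_n)$,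 $n\ge 0$; $\mathcal T_i$ is the set of these. For $\tau_1\in\mathcal T_1$, $\tau_2\in\mathcal T_2$ and $\{i,j\}=\{1,2\}$ put $$J_i(x;\tau_1,\tau_2)=\mathbb E_x\big[\alpha^{\tau_i}f_i(X_{\tau_i})1_{\{\tau_i<\tau_j\}}+\alpha^{\tau_j}g_i(X_{\tau_j})1_{\{\tau_j<\tau_i\}}+\alpha^{\tau_i}h_i(X_{\tau_i})1_{\{\tau_i=\tau_j<\infty\}}\big].$$ For measurable $p^{(i)}:E\to[0,1]$ let $\tau^{p^{(i)}}=\inf\{n\ge0: p^{(i)}(X_n)\ge\xi^{(i)}_n\}$ (with $\inf\emptyset=\infty$). The pair $(p^{(1)},p^{(2)})$ is a *global Markovian randomized equilibrium* if for every $x\in E$, $\tau^{p^{(1)}}\in\mathcal T_1$, $\tau^{p^{(2)}}\in\mathcal T_2$ and $$J_1(x;\tau^{p^{(1)}},\tau^{p^{(2)}})=\sup_{\tau_1\in\mathcal T_1}J_1(x;\tau_1,\tau^{p^{(2)}}),\qquad J_2(x;\tau^{p^{(1)}},\tau^{p^{(2)}})=\sup_{\tau_2\in\mathcal T_2}J_2(x;\tau^{p^{(1)}},\tau_2);$$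 its *values* are $V^{(i)}(x)=J_i(x;\tau^{p^{(1)}},\tau^{p^{(2)}})$, $x\in E$, $i=1,2$. Write $\Pi V(x)=\int_E V(y)\,\Pi(x,dy)$. **Theorem.** Let $p^{(1)},p^{(2)}:E\to[0,1]$ and $V^{(1)},V^{(2)}:E\to\mathbb R$ be measurable. Consider the system, for all $x\in E$ and $\{i,j\}=\{1,2\}$, with $$c_i(x)=(1-p^{(j)}(x))\,\alpha\,\Pi V^{(i)}(x)+p^{(j)}(x)g_i(x),\qquad s_i(x)=(1-p^{(j)}(x))f_i(x)+p^{(j)}(x)h_i(x):$$ $$V^{(i)}(x)=\max\{c_i(x),s_i(x)\},\qquad p^{(i)}(x)>0\Rightarrow c_i(x)\le s_i(x),\qquad p^{(i)}(x)<1\Rightarrow c_i(x)\ge s_i(x).\tag{S}$$ (A) If $(p^{(1)},p^{(2)})$ is a global Markovian randomized equilibrium with values $(V^{(1)},V^{(2)})$, then $V^{(i)}$ is $\Pi(x,\cdot)$-integrable for all $x\in E$ and $i=1,2$ (so that $\Pi V^{(i)}$ is well defined), and (S) holds. (B) If (S) holds and, for all $x\in E$ and $i=1,2$, $V^{(i)}(\tilde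 X_1)\in L^1(\mathbb P_x)$ and $\mathbb E_x\big[\sup_{n\ge 0}V^{(i)}(\tilde X_n)\big]<\infty$, then $(p^{(1)},p^{(2)})$ is a global Markovian randomized equilibrium with values $(V^{(1)},V^{(2)})$. -/

import Mathlib

open MeasureTheory ProbabilityTheory
open scoped ENNReal

noncomputable section

/-- A two-player discrete-time Markovian Dynkin game. The players are indexed by `Fin 2`
(`0` is the first player, `1` the second one); `i.rev` is the opponent of player `i`. -/
structure MarkovDynkinGame (E Ω : Type*) [MeasurableSpace E] [MeasurableSpace Ω] where
  /-- the discount factor `α` -/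
  disc : ℝ
  disc_pos : 0 < disc
  disc_lt_one : disc < 1
  /-- the one-step transition kernel of the state process -/
  kern : Kernel E E
  isMarkovKernel_kern : IsMarkovKernel kern
  /-- the law `P x` on `Ω` under which the state process starts from `x` -/
  P : E → Measure Ω
  isProbabilityMeasure_P : ∀ x, IsProbabilityMeasure (P x)
  /-- the state process -/
  X : ℕ → Ω → E
  measurable_X : ∀ n, Measurable (X n)
  /-- under `P x` the state process starts from `x` -/
  map_X_zero : ∀ x, (P x).map (X 0) = Measure.dirac x
  /-- the time-homogeneous Markov property with respect to the filtration
  `σ(X 0, …, X n)`: the conditional probability of `X (n + 1) ∈ B` is `kern (X n) B` -/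
  markov : ∀ (x : E) (n : ℕ) (A : Set Ω) (B : Set E),
    MeasurableSet[⨆ k ≤ n, MeasurableSpace.comap (X k) inferInstance] A → MeasurableSet B →
      P x (A ∩ X (n + 1) ⁻¹' B) = ∫⁻ ω in A, kern (X n ω) B ∂(P x)
  /-- the randomization devices: `ξ i n` is the one of player `i` at time `n` -/
  ξ : Fin 2 → ℕ → Ω → ℝ
  measurable_ξ : ∀ i n, Measurable (ξ i n)
  uniform_ξ : ∀ x i n, pdf.IsUniform (ξ i n) (Set.Ioo 0 1) (P x)
  iIndepFun_ξ : ∀ x, iIndepFun (fun k : Fin 2 × ℕ => ξ k.1 k.2) (P x)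
  indepFun_X_ξ : ∀ x,
    IndepFun (fun ω n => X n ω) (fun ω (k : Fin 2 × ℕ) => ξ k.1 k.2 ω) (P x)
  /-- the last time at which the killed process is still alive; it is geometric, so that
  killing takes place with probability `1 - α` at each of the times `1, 2, …` -/
  lifetime : Ω → ℕ∞
  measurable_lifetime : Measurable lifetime
  geometric_lifetime : ∀ x (n : ℕ), P x {ω | (n : ℕ∞) ≤ lifetime ω} = ENNReal.ofReal (disc ^ n)
  indepFun_X_lifetime : ∀ x, IndepFun (fun ω n => X n ω) lifetime (P x)
  /-- reward functions: `f i` if player `i` stops first, `g i` if the opponent stops first,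
  `h i` if both players stop simultaneously -/
  f : Fin 2 → E → ℝ
  g : Fin 2 → E → ℝ
  h : Fin 2 → E → ℝ
  measurable_f : ∀ i, Measurable (f i)
  measurable_g : ∀ i, Measurable (g i)
  measurable_h : ∀ i, Measurable (h i)

namespace MarkovDynkinGame

variable {E Ω : Type*} [MeasurableSpace E] [MeasurableSpace Ω] (G : MarkovDynkinGame E Ω)

/-- The killed process, with cemetery state `none`. -/
def killed (n : ℕ) (ω : Ω) : Option E :=
  open Classical in if (n : ℕ∞) ≤ G.lifetime ω then some (G.X n ω) else none

/-- The value of `φ` at the killed process at time `n`; functions vanish at the cemetery. -/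
def evalKilled (φ : E → ℝ) (n : ℕ) (ω : Ω) : ℝ := (G.killed n ω).elim 0 φ

/-- The running assumption: for `φ = f i, g i, h i`, the supremum over all times of the
absolute value of `φ` along the killed process is integrable under each `P x`. -/
def RewardsIntegrable : Prop :=
  ∀ (x : E) (i : Fin 2), ∀ φ ∈ ({G.f i, G.g i, G.h i} : Set (E → ℝ)),
    ∫⁻ ω, ⨆ n : ℕ, ‖G.evalKilled φ n ω‖ₑ ∂(G.P x) < ∞

/-- The information of player `i`: `σ(X 0, …, X n, ξ i 0, …, ξ i n)`. -/
def info (i : Fin 2) : Filtration ℕ (inferInstance : MeasurableSpace Ω) where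
  seq n := ⨆ k ≤ n, (MeasurableSpace.comap (G.X k) inferInstance ⊔
    MeasurableSpace.comap (G.ξ i k) inferInstance)
  mono' _ _ hmn := biSup_mono fun _ hk => hk.trans hmn
  le' _ := iSup₂_le fun k _ =>
    sup_le (G.measurable_X k).comap_le (G.measurable_ξ i k).comap_le

/-- Admissible stopping times of player `i` (the value `∞` is allowed). -/
def Admissible (i : Fin 2) (τ : Ω → ℕ∞) : Prop := IsStoppingTime (G.info i) τ

/-- The realized discounted reward of player `i` when the players use `τ 0`, `τ 1`. -/
def payoff (i : Fin 2) (τ : Fin 2 → Ω → ℕ∞) (ω : Ω) : ℝ :=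
  open Classical in
  if τ i ω < τ i.rev ω then
    G.disc ^ (τ i ω).toNat * G.f i (G.X (τ i ω).toNat ω)
  else if τ i.rev ω < τ i ω then
    G.disc ^ (τ i.rev ω).toNat * G.g i (G.X (τ i.rev ω).toNat ω)
  else if τ i ω < ⊤ then
    G.disc ^ (τ i ω).toNat * G.h i (G.X (τ i ω).toNat ω)
  else 0

/-- The expected reward `J_i(x; τ 0, τ 1)` of player `i`. -/
def J (i : Fin 2) (x : E) (τ : Fin 2 → Ω → ℕ∞) : ℝ := ∫ ω, G.payoff i τ ω ∂(G.P x)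

/-- `τ` is a Nash equilibrium for the initial state `x`. -/
def IsNashEquilibrium (x : E) (τ : Fin 2 → Ω → ℕ∞) : Prop :=
  (∀ i, G.Admissible i (τ i)) ∧
    ∀ i, IsLUB {r | ∃ σ, G.Admissible i σ ∧ r = G.J i x (Function.update τ i σ)} (G.J i x τ)

/-- The Markovian randomized stopping times `inf {n | p i (X n) ≥ ξ i n}`, `i = 0, 1`
(with `inf ∅ = ∞`). -/
def markovTime (p : Fin 2 → E → ℝ) (i : Fin 2) (ω : Ω) : ℕ∞ :=
  sInf {t : ℕ∞ | ∃ n : ℕ, t = n ∧ p i (G.X n ω) ≥ G.ξ i n ω}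

/-- `p` is a global Markovian randomized equilibrium. -/
def IsGlobalEquilibrium (p : Fin 2 → E → ℝ) : Prop :=
  ∀ x, G.IsNashEquilibrium x (G.markovTime p)

/-- `V` is the pair of values of `p`. -/
def HasValues (p V : Fin 2 → E → ℝ) : Prop := ∀ i x, V i x = G.J i x (G.markovTime p)

/-- `(1 - p_j(x)) α ∫ V_i(y) kern(x, dy) + p_j(x) g_i(x)`, with `j` the opponent of `i`. -/
def contValue (p V : Fin 2 → E → ℝ) (i : Fin 2) (x : E) : ℝ :=
  (1 - p i.rev x) * (G.disc * ∫ y, V i y ∂(G.kern x)) + p i.rev x * G.g i x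

/-- `(1 - p_j(x)) f_i(x) + p_j(x) h_i(x)`, with `j` the opponent of `i`. -/
def stopValue (p : Fin 2 → E → ℝ) (i : Fin 2) (x : E) : ℝ :=
  (1 - p i.rev x) * G.f i x + p i.rev x * G.h i x

/-- The Wald-Bellman type system. -/
def WaldBellmanSystem (p V : Fin 2 → E → ℝ) : Prop :=
  ∀ (i : Fin 2) (x : E),
    V i x = max (G.contValue p V i x) (G.stopValue p i x) ∧
    (0 < p i x → G.contValue p V i x ≤ G.stopValue p i x) ∧
    (p i x < 1 → G.contValue p V i x ≥ G.stopValue p i x)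

/-- The integrability conditions on `V`: the value of `V i` at the killed process at time `1` is
integrable, and `sup_n V_i` along the killed process has expectation less than `∞`. The killed
process almost surely reaches the cemetery, where functions vanish, so this supremum is almost
surely nonnegative and equals the supremum of the positive parts, which is the one used here. -/
def ValuesIntegrable (V : Fin 2 → E → ℝ) : Prop :=
  ∀ (i : Fin 2) (x : E),
    Integrable (G.evalKilled (V i) 1) (G.P x) ∧
    ∫⁻ ω, ⨆ n : ℕ, ENNReal.ofReal (G.evalKilled (V i) n ω) ∂(G.P x) < ∞

end MarkovDynkinGame

end

noncomputable section

open Filter Topology Set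

/-! ### Independence of generated σ-algebras. -/

section SigmaAlgebras

variable {Ω : Type*}

/-! The system says that each player does the best thing in one step against the opponent's
randomized Markov time.

Necessity compares two deviations of player `i` at the starting state. Stopping at once is worth
`stopValue` (`J_update_zero`). Never stopping at time 0 and following the randomized Markov time
afterwards is worth `contValue` (`J_update_delayedTime`), by the Markov property at time 1 for
functionals of states and devices (`integral_tail`). The player's own device at time 0 chooses
between the two, independently of everything else they depend on, so the value is their mixture with
weights `p` and `1 - p` (`J_markovTime_eq`). In equilibrium neither deviation exceeds the mixture.
Hence the value is the maximum, and a deviation of positive weight attains it.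

Sufficiency is a verification argument. For an admissible `σ`, add the expected reward from games
that end before `N` to the discounted expectation of `V i (X N)` over games still running at `N`. By
`setIntegral_running_step`, passing from `N` to `N + 1` replaces `V i` by `stopValue` where `σ = N`
and by `contValue` elsewhere. The system makes the resulting sequence nonincreasing, and constant
when `σ` is the randomized Markov time itself. It starts at `V i x`. Its reward part tends to `J`
(`hasSum_setIntegral_running`), and its remainder vanishes because the killed process dies almost
surely and `V i` is dominated along it (`tendsto_disc_mul_setIntegral`).

Both halves rest on averaging over a single device that is independent of the states and all other
devices (`setIntegral_ite_ξ`). Killing enters only through integrability and the vanishing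
remainder. -/

theorem isPiSystem_inter_sup (m₁ m₂ : MeasurableSpace Ω) :
    IsPiSystem {s | ∃ a b, MeasurableSet[m₁] a ∧ MeasurableSet[m₂] b ∧ a ∩ b = s} := by
  rintro _ ⟨a, b, ha, hb, rfl⟩ _ ⟨c, d, hc, hd, rfl⟩ -
  exact ⟨a ∩ c, b ∩ d, ha.inter hc, hb.inter hd, by rw [inter_inter_inter_comm]⟩

theorem sup_eq_generateFrom_inter (m₁ m₂ : MeasurableSpace Ω) :
    m₁ ⊔ m₂ = MeasurableSpace.generateFrom
      {s | ∃ a b, MeasurableSet[m₁] a ∧ MeasurableSet[m₂] b ∧ a ∩ b = s} := by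
  refine le_antisymm (sup_le ?_ ?_) (MeasurableSpace.generateFrom_le ?_)
  · exact fun s hs => MeasurableSpace.measurableSet_generateFrom
      ⟨s, univ, hs, MeasurableSet.univ, inter_univ s⟩
  · exact fun s hs => MeasurableSpace.measurableSet_generateFrom
      ⟨univ, s, MeasurableSet.univ, hs, univ_inter s⟩
  · rintro _ ⟨a, b, ha, hb, rfl⟩
    exact MeasurableSet.inter ((le_sup_left : m₁ ≤ m₁ ⊔ m₂) a ha)
      ((le_sup_right : m₂ ≤ m₁ ⊔ m₂) b hb)

/-- On generators, P(a ∩ b ∩ c) = P(b) P(a ∩ c) = P(b) P(a) P(c) = P(a) P(b ∩ c). In the application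
`m₁` is one device, `m₂` the state trajectory and `m₃` the remaining devices. -/
theorem indep_sup_right {m₁ m₂ m₃ mΩ : MeasurableSpace Ω} {μ : Measure Ω} [IsProbabilityMeasure μ]
    (h₁ : m₁ ≤ mΩ) (h₂ : m₂ ≤ mΩ) (h₃ : m₃ ≤ mΩ)
    (h₁₃ : Indep m₁ m₃ μ) (h : Indep m₂ (m₁ ⊔ m₃) μ) : Indep m₁ (m₂ ⊔ m₃) μ := by
  refine IndepSets.indep (p1 := {s | MeasurableSet[m₁] s}) h₁ (sup_le h₂ h₃)
    (@MeasurableSpace.isPiSystem_measurableSet Ω m₁) (isPiSystem_inter_sup m₂ m₃)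
    (@MeasurableSpace.generateFrom_measurableSet Ω m₁).symm (sup_eq_generateFrom_inter m₂ m₃) ?_
  rw [IndepSets_iff]
  rintro a _ ha ⟨b, c, hb, hc, rfl⟩
  rw [Indep_iff] at h h₁₃
  have e : a ∩ (b ∩ c) = b ∩ (a ∩ c) := inter_left_comm a b c
  have hm₁ : m₁ ≤ m₁ ⊔ m₃ := le_sup_left
  have hm₃ : m₃ ≤ m₁ ⊔ m₃ := le_sup_right
  rw [e, h b (a ∩ c) hb ((hm₁ a ha).inter (hm₃ c hc)), h₁₃ a c ha hc, h b c hb (hm₃ c hc)]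
  ring

end SigmaAlgebras

/-! ### Trajectories and the σ-algebras they generate. -/

namespace MarkovDynkinGame

variable {E Ω : Type*} [MeasurableSpace E] [mΩ : MeasurableSpace Ω] (G : MarkovDynkinGame E Ω)

instance : IsMarkovKernel G.kern := G.isMarkovKernel_kern

instance (x : E) : IsProbabilityMeasure (G.P x) := G.isProbabilityMeasure_P x

/-- The trajectory of the state process. -/
def path (ω : Ω) : ℕ → E := fun n => G.X n ω

/-- The trajectory of all randomization devices. -/
def noise (ω : Ω) : Fin 2 × ℕ → ℝ := fun k => G.ξ k.1 k.2 ω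

theorem measurable_path : Measurable G.path := measurable_pi_lambda _ G.measurable_X

theorem measurable_noise : Measurable G.noise :=
  measurable_pi_lambda _ fun k => G.measurable_ξ k.1 k.2

theorem indepFun_path_noise (x : E) : IndepFun G.path G.noise (G.P x) := G.indepFun_X_ξ x

/-- The history of the state process. -/
abbrev past (n : ℕ) : MeasurableSpace Ω :=
  ⨆ k ≤ n, MeasurableSpace.comap (G.X k) inferInstance

/-- The history of the state process, together with all randomization devices. -/
abbrev pastNoise (n : ℕ) : MeasurableSpace Ω :=
  G.past n ⊔ MeasurableSpace.comap G.noise inferInstance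

/-- Everything but the randomization device with index `k`. -/
abbrev others (k : Fin 2 × ℕ) : MeasurableSpace Ω :=
  MeasurableSpace.comap G.path inferInstance ⊔
    ⨆ l ∈ ({k}ᶜ : Set (Fin 2 × ℕ)), MeasurableSpace.comap (fun ω => G.ξ l.1 l.2 ω) inferInstance

theorem comap_X_le_comap_path (n : ℕ) :
    MeasurableSpace.comap (G.X n) inferInstance ≤ MeasurableSpace.comap G.path inferInstance :=
  ((measurable_pi_apply n).comp (comap_measurable G.path)).comap_le

theorem comap_ξ_le_comap_noise (k : Fin 2 × ℕ) :
    MeasurableSpace.comap (fun ω => G.ξ k.1 k.2 ω) inferInstance ≤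
      MeasurableSpace.comap G.noise inferInstance :=
  ((measurable_pi_apply k).comp (comap_measurable G.noise)).comap_le

theorem past_le_comap_path (n : ℕ) : G.past n ≤ MeasurableSpace.comap G.path inferInstance :=
  iSup₂_le fun k _ => G.comap_X_le_comap_path k

theorem past_le (n : ℕ) : G.past n ≤ mΩ :=
  (G.past_le_comap_path n).trans G.measurable_path.comap_le

theorem pastNoise_le (n : ℕ) : G.pastNoise n ≤ mΩ :=
  sup_le (G.past_le n) G.measurable_noise.comap_le

theorem others_le (k : Fin 2 × ℕ) : G.others k ≤ mΩ :=
  sup_le G.measurable_path.comap_le (iSup₂_le fun l _ => (G.measurable_ξ l.1 l.2).comap_le)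

theorem measurable_X_past {k n : ℕ} (h : k ≤ n) : Measurable[G.past n] (G.X k) :=
  Measurable.of_comap_le (le_iSup₂_of_le k h le_rfl)

theorem measurable_X_pastNoise {k n : ℕ} (h : k ≤ n) : Measurable[G.pastNoise n] (G.X k) :=
  (G.measurable_X_past h).mono le_sup_left le_rfl

theorem measurable_X_others (k : Fin 2 × ℕ) (n : ℕ) : Measurable[G.others k] (G.X n) :=
  Measurable.of_comap_le ((G.comap_X_le_comap_path n).trans le_sup_left)

theorem measurable_path_others (k : Fin 2 × ℕ) : Measurable[G.others k] G.path :=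
  Measurable.of_comap_le le_sup_left

theorem measurable_ξ_pastNoise (k : Fin 2 × ℕ) (n : ℕ) :
    Measurable[G.pastNoise n] (G.ξ k.1 k.2) :=
  Measurable.of_comap_le ((G.comap_ξ_le_comap_noise k).trans le_sup_right)

theorem measurable_ξ_others {k l : Fin 2 × ℕ} (h : l ≠ k) :
    Measurable[G.others k] (G.ξ l.1 l.2) :=
  Measurable.of_comap_le (le_sup_of_le_right (le_iSup₂_of_le l h le_rfl))

theorem info_le_pastNoise (i : Fin 2) (n : ℕ) : G.info i n ≤ G.pastNoise n :=
  iSup₂_le fun k hk => sup_le (G.measurable_X_pastNoise hk).comap_le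
    (G.measurable_ξ_pastNoise (i, k) n).comap_le

/-- A player never observes the opponent's devices. This is why the opponent's randomization can be
averaged out against an arbitrary admissible time. -/
theorem info_le_others {i j : Fin 2} (h : i ≠ j) (n m : ℕ) : G.info i n ≤ G.others (j, m) :=
  iSup₂_le fun k _ => sup_le (G.measurable_X_others _ k).comap_le
    (G.measurable_ξ_others (k := (j, m)) (l := (i, k)) fun e => h (congrArg Prod.fst e)).comap_le

/-! ### The Markov property -/

/-- The Markov property relative to the history and all randomization devices. -/
theorem markov_pastNoise (x : E) (n : ℕ) {S : Set Ω} (hS : MeasurableSet[G.pastNoise n] S)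
    {B : Set E} (hB : MeasurableSet B) :
    G.P x (S ∩ G.X (n + 1) ⁻¹' B) = ∫⁻ ω in S, G.kern (G.X n ω) B ∂(G.P x) := by
  have hXB := G.measurable_X (n + 1) hB
  have hle := G.pastNoise_le n
  have hk : Measurable fun ω => G.kern (G.X n ω) B :=
    (G.kern.measurable_coe hB).comp (G.measurable_X n)
  refine MeasurableSpace.induction_on_inter (m := G.pastNoise n)
    (C := fun S _ => G.P x (S ∩ G.X (n + 1) ⁻¹' B) = ∫⁻ ω in S, G.kern (G.X n ω) B ∂(G.P x))
    (sup_eq_generateFrom_inter _ _) (isPiSystem_inter_sup _ _) (by simp) ?_ ?_ ?_ S hS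
  -- On a rectangle, the event `c` of the devices is independent of the trajectory, so its
  -- probability factors out of both sides and the plain Markov property remains.
  · rintro _ ⟨a, c, ha, hc, rfl⟩
    have hi : Indep (MeasurableSpace.comap G.path inferInstance)
      (MeasurableSpace.comap G.noise inferInstance) (G.P x) := G.indepFun_path_noise x
    have ha' := G.past_le n a ha
    have hc' := G.measurable_noise.comap_le c hc
    rw [show a ∩ c ∩ G.X (n + 1) ⁻¹' B = a ∩ G.X (n + 1) ⁻¹' B ∩ c by
      rw [inter_right_comm]]
    rw [(Indep_iff _ _ _).1 hi _ c ((G.past_le_comap_path n a ha).inter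
      (G.comap_X_le_comap_path (n + 1) _ ⟨B, hB, rfl⟩)) hc, G.markov x n a B ha hB]
    rw [← lintegral_indicator ha', ← lintegral_indicator (ha'.inter hc')]
    have h1 : ∀ ω, (a ∩ c).indicator (fun ω => G.kern (G.X n ω) B) ω =
        a.indicator (fun ω => G.kern (G.X n ω) B) ω * c.indicator 1 ω := by
      intro ω
      by_cases h1 : ω ∈ a <;> by_cases h2 : ω ∈ c <;> simp [h1, h2]
    simp_rw [h1]
    rw [lintegral_mul_eq_lintegral_mul_lintegral_of_independent_measurableSpace
      G.measurable_path.comap_le G.measurable_noise.comap_le hi, lintegral_indicator_one hc']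
    · exact Measurable.indicator ((G.kern.measurable_coe hB).comp
        (Measurable.of_comap_le (G.comap_X_le_comap_path n))) (G.past_le_comap_path n a ha)
    · exact (@measurable_const ℝ≥0∞ Ω _ (MeasurableSpace.comap G.noise inferInstance)
      1).indicator hc
  · intro S hS h
    have hS' := hle S hS
    have e1 := measure_inter_add_sdiff (μ := G.P x) (G.X (n + 1) ⁻¹' B) hS'
    have e2 := lintegral_add_compl (μ := G.P x) (fun ω => G.kern (G.X n ω) B) hS'
    -- For complements, subtract from the identity on the whole space; finiteness of the measure
    -- permits the cancellation.
    have e3 := G.markov x n univ B MeasurableSet.univ hB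
    rw [univ_inter, Measure.restrict_univ] at e3
    rw [inter_comm, h] at e1
    rw [inter_comm, ← Set.sdiff_eq]
    rw [← e3, ← e1] at e2
    refine ((ENNReal.add_right_inj ?_).1 e2).symm
    rw [← h]
    exact measure_ne_top _ _
  · intro f hd hf h
    have hf' := fun i => hle (f i) (hf i)
    rw [iUnion_inter, measure_iUnion _ fun i => (hf' i).inter hXB, lintegral_iUnion hf' hd]
    · exact tsum_congr h
    · exact fun i j hij => (hd hij).mono inter_subset_left inter_subset_left

/-- Restricting to `S` before pushing forward turns the Markov property on events into an equality
of measures, from which the integral versions follow. -/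
theorem map_restrict_X_succ (x : E) (n : ℕ) {S : Set Ω} (hS : MeasurableSet[G.pastNoise n] S) :
    ((G.P x).restrict S).map (G.X (n + 1)) = G.kern ∘ₘ (((G.P x).restrict S).map (G.X n)) := by
  ext B hB
  rw [Measure.map_apply (G.measurable_X _) hB, Measure.restrict_apply (G.measurable_X _ hB),
    inter_comm, G.markov_pastNoise x n hS hB, Measure.bind_apply hB G.kern.measurable.aemeasurable,
    lintegral_map (G.kern.measurable_coe hB) (G.measurable_X n)]

theorem setLIntegral_X_succ (x : E) (n : ℕ) {S : Set Ω} (hS : MeasurableSet[G.pastNoise n] S)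
    {φ : E → ℝ≥0∞} (hφ : Measurable φ) :
    ∫⁻ ω in S, φ (G.X (n + 1) ω) ∂(G.P x) =
      ∫⁻ ω in S, ∫⁻ y, φ y ∂(G.kern (G.X n ω)) ∂(G.P x) := by
  rw [← lintegral_map hφ (G.measurable_X _), G.map_restrict_X_succ x n hS,
    Measure.lintegral_bind G.kern.measurable.aemeasurable hφ.aemeasurable,
    lintegral_map hφ.lintegral_kernel (G.measurable_X n)]

theorem integrable_kern_X (x : E) (n : ℕ) {φ : E → ℝ} (hφ : Measurable φ)
    (hi : Integrable (fun ω => φ (G.X (n + 1) ω)) (G.P x)) :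
    Integrable (fun ω => ∫ y, φ y ∂(G.kern (G.X n ω))) (G.P x) := by
  have e := G.map_restrict_X_succ x n MeasurableSet.univ
  rw [Measure.restrict_univ] at e
  have h := (integrable_map_measure hφ.aestronglyMeasurable (G.measurable_X _).aemeasurable).2 hi
  rw [e, Measure.comp_eq_comp_const_apply] at h
  have h2 := h.integral_comp
  rw [Kernel.const_apply] at h2
  exact h2.comp_measurable (G.measurable_X n)

theorem setIntegral_X_succ (x : E) (n : ℕ) {S : Set Ω} (hS : MeasurableSet[G.pastNoise n] S)
    {φ : E → ℝ} (hφ : Measurable φ) (hi : Integrable (fun ω => φ (G.X (n + 1) ω)) (G.P x)) :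
    ∫ ω in S, φ (G.X (n + 1) ω) ∂(G.P x) =
      ∫ ω in S, ∫ y, φ y ∂(G.kern (G.X n ω)) ∂(G.P x) := by
  have e := G.map_restrict_X_succ x n hS
  have h := (integrable_map_measure hφ.aestronglyMeasurable (G.measurable_X _).aemeasurable).2
    (hi.restrict (s := S))
  rw [← integral_map (G.measurable_X _).aemeasurable hφ.aestronglyMeasurable]
  rw [e, Measure.comp_eq_comp_const_apply] at h ⊢
  rw [Kernel.integral_comp h, Kernel.const_apply,
    integral_map (G.measurable_X n).aemeasurable]
  exact hφ.stronglyMeasurable.integral_kernel.aestronglyMeasurable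

/-! ### The initial state -/

theorem lintegral_X_zero (x : E) {φ : E → ℝ≥0∞} (hφ : Measurable φ) :
    ∫⁻ ω, φ (G.X 0 ω) ∂(G.P x) = φ x := by
  rw [← lintegral_map hφ (G.measurable_X 0), G.map_X_zero, lintegral_dirac' x hφ]

theorem ae_X_zero (x : E) {φ : E → ℝ} (hφ : Measurable φ) :
    ∀ᵐ ω ∂(G.P x), φ (G.X 0 ω) = φ x := by
  have hs : MeasurableSet {y | φ y = φ x} := hφ (measurableSet_singleton (φ x))
  refine (ae_map_iff (G.measurable_X 0).aemeasurable hs).1 ?_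
  rw [G.map_X_zero, ae_dirac_iff hs]

/-! ### The randomization devices -/

theorem indep_ξ_others (x : E) (k : Fin 2 × ℕ) :
    Indep (MeasurableSpace.comap (fun ω => G.ξ k.1 k.2 ω) inferInstance) (G.others k) (G.P x) := by
  have hle : ∀ l : Fin 2 × ℕ,
      MeasurableSpace.comap (fun ω => G.ξ l.1 l.2 ω) inferInstance ≤ mΩ :=
    fun l => (G.measurable_ξ l.1 l.2).comap_le
  have h1 := indep_iSup_of_disjoint hle (G.iIndepFun_ξ x).iIndep
    (disjoint_compl_right : Disjoint {k} ({k}ᶜ : Set (Fin 2 × ℕ)))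
  simp only [mem_singleton_iff, iSup_iSup_eq_left] at h1
  refine indep_sup_right (hle k) G.measurable_path.comap_le (iSup₂_le fun l _ => hle l) h1 ?_
  exact indep_of_indep_of_le_right (G.indepFun_path_noise x)
    (sup_le (G.comap_ξ_le_comap_noise k) (iSup₂_le fun l _ => G.comap_ξ_le_comap_noise l))

theorem map_ξ (x : E) (i : Fin 2) (n : ℕ) :
    (G.P x).map (G.ξ i n) = volume.restrict (Ioo 0 1) := by
  have h : (G.P x).map (G.ξ i n) = ProbabilityTheory.cond volume (Ioo 0 1) := G.uniform_ξ x i n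
  rw [h, ProbabilityTheory.cond]
  simp

theorem ae_ξ_mem (x : E) (i : Fin 2) (n : ℕ) : ∀ᵐ ω ∂(G.P x), G.ξ i n ω ∈ Ioo (0 : ℝ) 1 := by
  refine ae_of_ae_map (G.measurable_ξ i n).aemeasurable ?_
  rw [G.map_ξ]
  exact ae_restrict_mem measurableSet_Ioo

/-- Averaging over the randomization device with index `k`. -/
theorem setIntegral_ξ_le (x : E) (k : Fin 2 × ℕ) {Z a : Ω → ℝ} (hZ : Measurable[G.others k] Z)
    (hi : Integrable Z (G.P x)) (ha : Measurable[G.others k] a) (ha01 : ∀ ω, a ω ∈ Icc (0 : ℝ) 1) :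
    ∫ ω in {ω | G.ξ k.1 k.2 ω ≤ a ω}, Z ω ∂(G.P x) = ∫ ω, a ω * Z ω ∂(G.P x) := by
  have hZ' := hZ.mono (G.others_le k) le_rfl
  have ha' := ha.mono (G.others_le k) le_rfl
  have hξ := G.measurable_ξ k.1 k.2
  -- The pair `W` is independent of the device, so the joint law is a product and Fubini integrates
  -- the device out for fixed values of `Z` and `a`.
  set W : Ω → ℝ × ℝ := fun ω => (Z ω, a ω) with hW
  have hWm : Measurable W := hZ'.prodMk ha'
  have hind : IndepFun W (G.ξ k.1 k.2) (G.P x) :=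
    (indep_of_indep_of_le_right (G.indep_ξ_others x k)
      (Measurable.comap_le (hZ.prodMk ha))).symm
  have hprod := (indepFun_iff_map_prod_eq_prod_map_map hWm.aemeasurable hξ.aemeasurable).1 hind
  rw [G.map_ξ] at hprod
  set F : (ℝ × ℝ) × ℝ → ℝ := fun q => {q : (ℝ × ℝ) × ℝ | q.2 ≤ q.1.2}.indicator
    (fun q => q.1.1) q with hF
  have hFs : MeasurableSet {q : (ℝ × ℝ) × ℝ | q.2 ≤ q.1.2} :=
    measurableSet_le measurable_snd measurable_fst.snd
  have hFm : Measurable F := measurable_fst.fst.indicator hFs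
  have hms : MeasurableSet {ω | G.ξ k.1 k.2 ω ≤ a ω} := measurableSet_le hξ ha'
  have e1 : ∀ ω, {ω | G.ξ k.1 k.2 ω ≤ a ω}.indicator Z ω = F (W ω, G.ξ k.1 k.2 ω) := by
    intro ω
    by_cases h : G.ξ k.1 k.2 ω ≤ a ω <;> simp [hF, hW, indicator, h]
  have hFi : Integrable F (((G.P x).map W).prod (volume.restrict (Ioo 0 1))) := by
    rw [← hprod, integrable_map_measure hFm.aestronglyMeasurable (hWm.prodMk hξ).aemeasurable]
    exact (integrable_congr (ae_of_all _ e1)).1 (hi.indicator hms)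
  have : SFinite ((G.P x).map W) := inferInstance
  calc ∫ ω in {ω | G.ξ k.1 k.2 ω ≤ a ω}, Z ω ∂(G.P x)
      = ∫ ω, F (W ω, G.ξ k.1 k.2 ω) ∂(G.P x) := by
        rw [← integral_indicator hms]
        exact integral_congr_ae (ae_of_all _ e1)
    _ = ∫ q, F q ∂(((G.P x).map W).prod (volume.restrict (Ioo 0 1))) := by
        rw [← hprod, integral_map (hWm.prodMk hξ).aemeasurable hFm.aestronglyMeasurable]
    _ = ∫ w, (∫ u in Ioo (0 : ℝ) 1, F (w, u)) ∂((G.P x).map W) := integral_prod F hFi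
    _ = ∫ ω, (∫ u in Ioo (0 : ℝ) 1, F (W ω, u)) ∂(G.P x) := by
        rw [integral_map hWm.aemeasurable]
        exact hFm.stronglyMeasurable.integral_prod_right'.aestronglyMeasurable
    _ = ∫ ω, a ω * Z ω ∂(G.P x) := by
        refine integral_congr_ae (ae_of_all _ fun ω => ?_)
        have e2 : ∀ u, F (W ω, u) = (Iic (a ω)).indicator (fun _ => Z ω) u := by
          intro u
          by_cases h : u ≤ a ω <;> simp [hF, hW, indicator, h]
        simp_rw [e2]
        rw [integral_indicator measurableSet_Iic, setIntegral_const, smul_eq_mul]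
        congr 1
        -- The two sets differ at most at the endpoint 1, when `a ω = 1`.
        have e3 : (Iic (a ω) ∩ Ioo (0 : ℝ) 1 : Set ℝ) =ᵐ[volume] Ioc 0 (a ω) := by
          have h1 : ∀ᵐ u : ℝ, u ≠ 1 := by simp [ae_iff]
          filter_upwards [h1] with u hu
          refine propext ⟨fun h => ⟨h.2.1, h.1⟩, fun h => ⟨h.2, h.1, ?_⟩⟩
          exact lt_of_le_of_ne (h.2.trans (ha01 ω).2) hu
        rw [measureReal_restrict_apply measurableSet_Iic, measureReal_congr e3]
        simp [(ha01 ω).1]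

/-! ### Time shifts -/

/-- The trajectory of the state process from time `1` on. -/
def pathTail (ω : Ω) : ℕ → E := fun n => G.X (n + 1) ω

/-- The randomization devices from time `1` on. -/
def noiseTail (ω : Ω) : Fin 2 × ℕ → ℝ := fun k => G.ξ k.1 (k.2 + 1) ω

theorem measurable_pathTail : Measurable G.pathTail :=
  measurable_pi_lambda _ fun n => G.measurable_X (n + 1)

theorem measurable_noiseTail : Measurable G.noiseTail :=
  measurable_pi_lambda _ fun k => G.measurable_ξ k.1 (k.2 + 1)

/-- Conditioning at the last constrained time absorbs the last constraint into the test function.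
The offset `m` serves both the trajectory (`m = 0`) and its shift (`m = 1`). -/
theorem setLIntegral_box_succ (x : E) {B : ℕ → Set E} (hB : ∀ k, MeasurableSet (B k)) (n : ℕ)
    {φ : E → ℝ≥0∞} (hφ : Measurable φ) (m : ℕ) :
    ∫⁻ ω in {ω | ∀ k < n + 1, G.X (k + m) ω ∈ B k}, φ (G.X (n + 1 + m) ω) ∂(G.P x) =
      ∫⁻ ω in {ω | ∀ k < n, G.X (k + m) ω ∈ B k},
        (B n).indicator (fun y => ∫⁻ z, φ z ∂(G.kern y)) (G.X (n + m) ω) ∂(G.P x) := by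
  have hS : MeasurableSet[G.pastNoise (n + m)] {ω | ∀ k < n + 1, G.X (k + m) ω ∈ B k} := by
    simp only [ofPred_forall]
    exact MeasurableSet.iInter fun k => MeasurableSet.iInter fun hk =>
      (G.measurable_X_pastNoise (by omega)) (hB k)
  have hS' : {ω | ∀ k < n + 1, G.X (k + m) ω ∈ B k} =
      G.X (n + m) ⁻¹' (B n) ∩ {ω | ∀ k < n, G.X (k + m) ω ∈ B k} := by
    ext ω
    simp only [mem_ofPred_eq, mem_inter_iff, mem_preimage, Nat.lt_succ_iff_lt_or_eq]
    constructor
    · exact fun h => ⟨h n (Or.inr rfl), fun k hk => h k (Or.inl hk)⟩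
    · rintro ⟨h1, h2⟩ k (hk | rfl)
      exacts [h2 k hk, h1]
  rw [show n + 1 + m = n + m + 1 by ring, G.setLIntegral_X_succ x (n + m) hS hφ, hS',
    ← Measure.restrict_restrict (G.measurable_X _ (hB n)),
    ← lintegral_indicator (G.measurable_X _ (hB n))]
  rfl

/-- Measurability of `x ↦ P x` is not part of the structure; on finite-dimensional events it is
inherited from the transition kernel. -/
theorem measurable_setLIntegral_box {B : ℕ → Set E} (hB : ∀ k, MeasurableSet (B k)) (n : ℕ) :
    ∀ {φ : E → ℝ≥0∞}, Measurable φ →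
      Measurable fun y => ∫⁻ ω in {ω | ∀ k < n, G.X k ω ∈ B k}, φ (G.X n ω) ∂(G.P y) := by
  induction n with
  | zero =>
    intro φ hφ
    simpa [G.lintegral_X_zero _ hφ] using hφ
  | succ n ih =>
    intro φ hφ
    have h := fun y => G.setLIntegral_box_succ y hB n hφ 0
    simp only [add_zero] at h
    simp_rw [h]
    exact ih (hφ.lintegral_kernel.indicator (hB n))

theorem setLIntegral_box_tail (x : E) {B : ℕ → Set E} (hB : ∀ k, MeasurableSet (B k)) (n : ℕ) :
    ∀ {φ : E → ℝ≥0∞}, Measurable φ →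
      ∫⁻ ω in {ω | ∀ k < n, G.X (k + 1) ω ∈ B k}, φ (G.X (n + 1) ω) ∂(G.P x) =
        ∫⁻ y, ∫⁻ ω in {ω | ∀ k < n, G.X k ω ∈ B k}, φ (G.X n ω) ∂(G.P y) ∂(G.kern x) := by
  induction n with
  | zero =>
    intro φ hφ
    have h := G.setLIntegral_X_succ x 0 MeasurableSet.univ hφ
    simp only [Measure.restrict_univ, zero_add] at h
    simp only [not_lt_zero, IsEmpty.forall_iff, implies_true, ofPred_true, Measure.restrict_univ,
      zero_add, G.lintegral_X_zero _ hφ]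
    rw [h, G.lintegral_X_zero x (φ := fun y => ∫⁻ z, φ z ∂(G.kern y)) hφ.lintegral_kernel]
  | succ n ih =>
    intro φ hφ
    have h := fun y => G.setLIntegral_box_succ y hB n hφ 0
    simp only [add_zero] at h
    simp_rw [h]
    rw [G.setLIntegral_box_succ x hB n hφ 1, ih (hφ.lintegral_kernel.indicator (hB n))]

/-- Square cylinders over `ℕ` are boxes bounded in time. -/
theorem exists_box_of_mem_squareCylinders {S : Set (ℕ → E)}
    (hS : S ∈ squareCylinders fun _ : ℕ => {s : Set E | MeasurableSet s}) :
    ∃ (n : ℕ) (B : ℕ → Set E), (∀ k, MeasurableSet (B k)) ∧ S = {a | ∀ k < n, a k ∈ B k} := by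
  classical
  obtain ⟨s, t, ht, rfl⟩ := hS
  -- The time bound is strict, hence the `+ 1`; coordinates outside `s` are left unconstrained.
  refine ⟨s.sup id + 1, fun k => if k ∈ s then t k else univ, fun k => ?_, ?_⟩
  · dsimp only
    split_ifs
    exacts [ht k (mem_univ k), MeasurableSet.univ]
  · ext a
    simp only [Set.mem_pi, Finset.mem_coe, mem_ofPred_eq]
    refine ⟨fun h k _ => ?_, fun h k hk => ?_⟩
    · split_ifs with hk
      exacts [h k hk, mem_univ _]
    · have := h k (Nat.lt_succ_of_le (Finset.le_sup (f := id) hk))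
      rwa [if_pos hk] at this

theorem isPiSystem_squareCylinders_nat :
    IsPiSystem (squareCylinders fun _ : ℕ => {s : Set E | MeasurableSet s}) :=
  isPiSystem_squareCylinders (fun _ => MeasurableSpace.isPiSystem_measurableSet)
    fun _ => MeasurableSet.univ

theorem measurableSet_box {B : ℕ → Set E} (hB : ∀ k, MeasurableSet (B k)) (n : ℕ) :
    MeasurableSet {a : ℕ → E | ∀ k < n, a k ∈ B k} := by
  simp only [ofPred_forall]
  exact MeasurableSet.iInter fun k => MeasurableSet.iInter fun _ => measurable_pi_apply k (hB k)

/-- The law of the state process as a kernel. -/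
def pathLaw : Kernel E (ℕ → E) where
  toFun x := (G.P x).map G.path
  measurable' := by
    have : ∀ x, IsProbabilityMeasure ((G.P x).map G.path) :=
      fun x => Measure.isProbabilityMeasure_map G.measurable_path.aemeasurable
    refine Measurable.measure_of_isPiSystem_of_isProbabilityMeasure
      generateFrom_squareCylinders.symm isPiSystem_squareCylinders_nat fun S hS => ?_
    obtain ⟨n, B, hB, rfl⟩ := exists_box_of_mem_squareCylinders hS
    simp_rw [Measure.map_apply G.measurable_path (measurableSet_box hB n)]
    simpa using! G.measurable_setLIntegral_box hB n (φ := 1) measurable_one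

theorem pathLaw_apply (x : E) : G.pathLaw x = (G.P x).map G.path := rfl

instance : IsMarkovKernel G.pathLaw :=
  ⟨fun _ => Measure.isProbabilityMeasure_map G.measurable_path.aemeasurable⟩

/-- Boxes form a generating π-system, so it suffices to match finite-dimensional laws;
time-homogeneity gives these by induction. -/
theorem map_pathTail (x : E) : (G.P x).map G.pathTail = G.pathLaw ∘ₘ G.kern x := by
  have := Measure.isProbabilityMeasure_map (μ := G.P x) G.measurable_pathTail.aemeasurable
  refine ext_of_generate_finite _ generateFrom_squareCylinders.symm isPiSystem_squareCylinders_nat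
    (fun S hS => ?_) (by simp)
  obtain ⟨n, B, hB, rfl⟩ := exists_box_of_mem_squareCylinders hS
  have hm := measurableSet_box hB n
  rw [Measure.bind_apply hm G.pathLaw.measurable.aemeasurable]
  simp_rw [pathLaw_apply, Measure.map_apply G.measurable_path hm]
  rw [Measure.map_apply G.measurable_pathTail hm]
  simpa using! G.setLIntegral_box_tail x hB n (φ := 1) measurable_one

/-- The law of the randomization devices. -/
def noiseLaw : Measure (Fin 2 × ℕ → ℝ) :=
  Measure.infinitePi fun _ => volume.restrict (Ioo (0 : ℝ) 1)

theorem map_noise (x : E) : (G.P x).map G.noise = noiseLaw := by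
  have h := (G.iIndepFun_ξ x).map_fun_eq_infinitePi_map fun k : Fin 2 × ℕ => G.measurable_ξ k.1 k.2
  simp_rw [G.map_ξ] at h
  exact h

theorem map_noiseTail (x : E) : (G.P x).map G.noiseTail = noiseLaw := by
  have hinj : Function.Injective fun k : Fin 2 × ℕ => (k.1, k.2 + 1) := by
    rintro ⟨i, n⟩ ⟨j, m⟩ h
    simpa using h
  have h := ((G.iIndepFun_ξ x).precomp hinj).map_fun_eq_infinitePi_map
    fun k : Fin 2 × ℕ => G.measurable_ξ k.1 (k.2 + 1)
  simp_rw [G.map_ξ] at h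
  exact h

/-- The joint law of the state process and the randomization devices as a kernel. -/
def jointLaw : Kernel E ((ℕ → E) × (Fin 2 × ℕ → ℝ)) := G.pathLaw ×ₖ Kernel.const E noiseLaw

instance : IsProbabilityMeasure (volume.restrict (Ioo (0 : ℝ) 1)) := ⟨by simp⟩

instance : IsProbabilityMeasure noiseLaw := by
  unfold noiseLaw
  infer_instance

theorem jointLaw_apply (x : E) :
    G.jointLaw x = (G.P x).map fun ω => (G.path ω, G.noise ω) := by
  rw [jointLaw, Kernel.prod_apply, Kernel.const_apply,
    (indepFun_iff_map_prod_eq_prod_map_map G.measurable_path.aemeasurable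
      G.measurable_noise.aemeasurable).1 (G.indepFun_path_noise x), G.map_noise, pathLaw_apply]

/-- The law of the devices does not depend on the initial state, so forming the product with it
commutes with mixing over the state at time 1. -/
theorem map_tail (x : E) :
    (G.P x).map (fun ω => (G.pathTail ω, G.noiseTail ω)) = G.jointLaw ∘ₘ G.kern x := by
  have hind : IndepFun G.pathTail G.noiseTail (G.P x) :=
    (G.indepFun_path_noise x).comp
      (φ := fun (a : ℕ → E) n => a (n + 1))
      (ψ := fun (u : Fin 2 × ℕ → ℝ) (k : Fin 2 × ℕ) => u (k.1, k.2 + 1))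
      (measurable_pi_lambda _ fun n => measurable_pi_apply (n + 1))
      (measurable_pi_lambda _ fun k : Fin 2 × ℕ => measurable_pi_apply (k.1, k.2 + 1))
  rw [(indepFun_iff_map_prod_eq_prod_map_map G.measurable_pathTail.aemeasurable
    G.measurable_noiseTail.aemeasurable).1 hind, G.map_noiseTail, G.map_pathTail]
  refine Measure.prod_eq fun s t hs ht => ?_
  rw [Measure.bind_apply (hs.prod ht) G.jointLaw.measurable.aemeasurable,
    Measure.bind_apply hs G.pathLaw.measurable.aemeasurable,
    ← lintegral_mul_const _ (G.pathLaw.measurable_coe hs)]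
  refine lintegral_congr fun y => ?_
  rw [jointLaw, Kernel.prod_apply, Kernel.const_apply, Measure.prod_prod]

/-- The Markov property at time `1` for functionals of the future. -/
theorem integral_tail (x : E) {F : (ℕ → E) × (Fin 2 × ℕ → ℝ) → ℝ} (hF : Measurable F)
    (hi : Integrable (fun ω => F (G.pathTail ω, G.noiseTail ω)) (G.P x)) :
    Integrable (fun y => ∫ ω, F (G.path ω, G.noise ω) ∂(G.P y)) (G.kern x) ∧
      ∫ ω, F (G.pathTail ω, G.noiseTail ω) ∂(G.P x) =
        ∫ y, ∫ ω, F (G.path ω, G.noise ω) ∂(G.P y) ∂(G.kern x) := by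
  have hm := (G.measurable_pathTail.prodMk G.measurable_noiseTail).aemeasurable (μ := G.P x)
  have h := (integrable_map_measure hF.aestronglyMeasurable hm).2 hi
  have e : ∀ y, ∫ q, F q ∂(G.jointLaw y) = ∫ ω, F (G.path ω, G.noise ω) ∂(G.P y) := fun y => by
    rw [jointLaw_apply, integral_map
      (G.measurable_path.prodMk G.measurable_noise).aemeasurable hF.aestronglyMeasurable]
  rw [← integral_map hm hF.aestronglyMeasurable]
  rw [map_tail, Measure.comp_eq_comp_const_apply] at h ⊢
  simp_rw [← e]
  rw [Kernel.integral_comp h, Kernel.const_apply]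
  exact ⟨by simpa using h.integral_comp, rfl⟩

/-! ### Killing and discounting -/

/-- A nonnegative function along the killed process. -/
def killedVal (φ : E → ℝ≥0∞) (n : ℕ) (ω : Ω) : ℝ≥0∞ :=
  {ω | (n : ℕ∞) ≤ G.lifetime ω}.indicator (fun ω => φ (G.X n ω)) ω

theorem enorm_evalKilled (φ : E → ℝ) (n : ℕ) (ω : Ω) :
    ‖G.evalKilled φ n ω‖ₑ = G.killedVal (fun y => ‖φ y‖ₑ) n ω := by
  by_cases h : (n : ℕ∞) ≤ G.lifetime ω <;> simp [evalKilled, killed, killedVal, h]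

theorem ofReal_evalKilled (φ : E → ℝ) (n : ℕ) (ω : Ω) :
    ENNReal.ofReal (G.evalKilled φ n ω) = G.killedVal (fun y => ENNReal.ofReal (φ y)) n ω := by
  by_cases h : (n : ℕ∞) ≤ G.lifetime ω <;> simp [evalKilled, killed, killedVal, h]

theorem measurableSet_alive (n : ℕ) : MeasurableSet {ω | (n : ℕ∞) ≤ G.lifetime ω} :=
  G.measurable_lifetime (MeasurableSet.of_discrete (s := {t : ℕ∞ | (n : ℕ∞) ≤ t}))

theorem measurable_killedVal {φ : E → ℝ≥0∞} (hφ : Measurable φ) (n : ℕ) :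
    Measurable (G.killedVal φ n) :=
  (hφ.comp (G.measurable_X n)).indicator (G.measurableSet_alive n)

/-- The supremum of the discounted values is dominated by the supremum along the killed process. -/
theorem lintegral_iSup_disc_le (x : E) {φ : E → ℝ≥0∞} (hφ : Measurable φ) :
    ∫⁻ ω, ⨆ n : ℕ, ENNReal.ofReal (G.disc ^ n) * φ (G.X n ω) ∂(G.P x) ≤
      ∫⁻ ω, ⨆ n : ℕ, G.killedVal φ n ω ∂(G.P x) := by
  set F : (ℕ → E) × ℕ∞ → ℝ≥0∞ := fun q => ⨆ n : ℕ,
    {q : (ℕ → E) × ℕ∞ | (n : ℕ∞) ≤ q.2}.indicator (fun q => φ (q.1 n)) q with hF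
  have hFm : Measurable F := by
    refine Measurable.iSup fun n => Measurable.indicator ?_ ?_
    · exact hφ.comp ((measurable_pi_apply n).comp measurable_fst)
    · exact measurable_snd (MeasurableSet.of_discrete (s := {t : ℕ∞ | (n : ℕ∞) ≤ t}))
  have hm := G.measurable_path.prodMk G.measurable_lifetime
  have hdm : Measurable fun a : ℕ → E => ⨆ n : ℕ, ENNReal.ofReal (G.disc ^ n) * φ (a n) :=
    Measurable.iSup fun n => (hφ.comp (measurable_pi_apply n)).const_mul _
  have hind : IndepFun G.path G.lifetime (G.P x) := G.indepFun_X_lifetime x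
  have := Measure.isProbabilityMeasure_map (μ := G.P x) G.measurable_lifetime.aemeasurable
  calc ∫⁻ ω, ⨆ n : ℕ, ENNReal.ofReal (G.disc ^ n) * φ (G.X n ω) ∂(G.P x)
      = ∫⁻ a, ⨆ n : ℕ, ENNReal.ofReal (G.disc ^ n) * φ (a n) ∂((G.P x).map G.path) := by
        rw [lintegral_map hdm G.measurable_path]
        rfl
    _ ≤ ∫⁻ a, (∫⁻ t, F (a, t) ∂((G.P x).map G.lifetime)) ∂((G.P x).map G.path) := by
        -- Since `disc ^ n` is the probability of being alive at `n`, each discounted term is an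
        -- average over the lifetime, and a supremum of averages is at most the average of the
        -- supremum.
        refine lintegral_mono fun a => iSup_le fun n => ?_
        have hs : MeasurableSet {t : ℕ∞ | (n : ℕ∞) ≤ t} := MeasurableSet.of_discrete
        calc ENNReal.ofReal (G.disc ^ n) * φ (a n)
            = ∫⁻ t, {t : ℕ∞ | (n : ℕ∞) ≤ t}.indicator (fun _ => φ (a n)) t
                ∂((G.P x).map G.lifetime) := by
              rw [lintegral_indicator_const hs, Measure.map_apply G.measurable_lifetime hs,
                mul_comm, ← G.geometric_lifetime x n]
              rfl
          _ ≤ _ := lintegral_mono fun t =>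
              le_iSup (fun n : ℕ => {q : (ℕ → E) × ℕ∞ | (n : ℕ∞) ≤ q.2}.indicator
                (fun q => φ (q.1 n)) (a, t)) n
    _ = ∫⁻ q, F q ∂(((G.P x).map G.path).prod ((G.P x).map G.lifetime)) :=
        (lintegral_prod _ hFm.aemeasurable).symm
    _ = ∫⁻ ω, ⨆ n : ℕ, G.killedVal φ n ω ∂(G.P x) := by
        rw [← (indepFun_iff_map_prod_eq_prod_map_map G.measurable_path.aemeasurable
          G.measurable_lifetime.aemeasurable).1 hind, lintegral_map hFm hm]
        rfl

theorem lintegral_killedVal (x : E) {φ : E → ℝ≥0∞} (hφ : Measurable φ) (n : ℕ) :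
    ∫⁻ ω, G.killedVal φ n ω ∂(G.P x) =
      ENNReal.ofReal (G.disc ^ n) * ∫⁻ ω, φ (G.X n ω) ∂(G.P x) := by
  have h := lintegral_mul_eq_lintegral_mul_lintegral_of_indepFun'' (μ := G.P x)
    (f := fun ω => {t : ℕ∞ | (n : ℕ∞) ≤ t}.indicator (1 : ℕ∞ → ℝ≥0∞) (G.lifetime ω))
    (g := fun ω => φ (G.X n ω))
    ((Measurable.of_discrete (f := {t : ℕ∞ | (n : ℕ∞) ≤ t}.indicator
      (1 : ℕ∞ → ℝ≥0∞))).comp G.measurable_lifetime).aemeasurable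
    (hφ.comp (G.measurable_X n)).aemeasurable
    ((G.indepFun_X_lifetime x).symm.comp
      (φ := {t : ℕ∞ | (n : ℕ∞) ≤ t}.indicator (1 : ℕ∞ → ℝ≥0∞)) (ψ := fun a : ℕ → E => φ (a n))
      Measurable.of_discrete (hφ.comp (measurable_pi_apply n)))
  rw [← G.geometric_lifetime x n, ← lintegral_indicator_one (G.measurableSet_alive n)]
  refine Eq.trans (lintegral_congr fun ω => ?_) h
  by_cases hω : (n : ℕ∞) ≤ G.lifetime ω <;> simp [killedVal, hω]

theorem ae_lifetime_lt_top (x : E) : ∀ᵐ ω ∂(G.P x), G.lifetime ω < ⊤ := by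
  have h : Tendsto (fun n : ℕ => ENNReal.ofReal (G.disc ^ n)) atTop (𝓝 0) := by
    simpa using ENNReal.tendsto_ofReal
      (tendsto_pow_atTop_nhds_zero_of_lt_one G.disc_pos.le G.disc_lt_one)
  refine le_antisymm (ge_of_tendsto' h fun n => ?_) zero_le
  rw [← G.geometric_lifetime x n]
  refine measure_mono fun ω hω => ?_
  have hω' : G.lifetime ω = ⊤ := by simpa using hω
  simp [hω']

/-- Discounting equals killing in expectation. Along the killed process the values are eventually 0
almost surely, and their supremum is an integrable dominating function. -/
theorem tendsto_disc_mul_lintegral (x : E) {φ : E → ℝ≥0∞} (hφ : Measurable φ)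
    (h : ∫⁻ ω, ⨆ n : ℕ, G.killedVal φ n ω ∂(G.P x) < ∞) :
    Tendsto (fun n : ℕ => ENNReal.ofReal (G.disc ^ n) * ∫⁻ ω, φ (G.X n ω) ∂(G.P x))
      atTop (𝓝 0) := by
  simp_rw [← G.lintegral_killedVal x hφ]
  have := tendsto_lintegral_of_dominated_convergence (μ := G.P x) (F := G.killedVal φ) (f := 0)
    (fun ω => ⨆ n : ℕ, G.killedVal φ n ω) (G.measurable_killedVal hφ)
    (fun n => ae_of_all _ fun ω => le_iSup (fun n => G.killedVal φ n ω) n) h.ne ?_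
  · simpa using this
  filter_upwards [G.ae_lifetime_lt_top x] with ω hω
  refine tendsto_const_nhds.congr' ?_
  filter_upwards [eventually_gt_atTop (G.lifetime ω).toNat] with n hn
  have : ¬ (n : ℕ∞) ≤ G.lifetime ω := by
    rw [← ENat.natCast_toNat hω.ne, Nat.cast_le]
    omega
  simp [killedVal, this]

theorem lintegral_X_lt_top (x : E) {φ : E → ℝ≥0∞} (hφ : Measurable φ)
    (h : ∫⁻ ω, ⨆ n : ℕ, G.killedVal φ n ω ∂(G.P x) < ∞) (n : ℕ) :
    ∫⁻ ω, φ (G.X n ω) ∂(G.P x) < ∞ := by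
  have h1 : ENNReal.ofReal (G.disc ^ n) * ∫⁻ ω, φ (G.X n ω) ∂(G.P x) < ∞ := by
    rw [← G.lintegral_killedVal x hφ]
    exact (lintegral_mono fun ω => le_iSup (fun n => G.killedVal φ n ω) n).trans_lt h
  have h2 := ENNReal.ofReal_pos.2 (pow_pos G.disc_pos n)
  by_contra h3
  rw [not_lt, top_le_iff] at h3
  rw [h3, ENNReal.mul_top h2.ne'] at h1
  exact lt_irrefl _ h1

/-! ### Rewards as functionals of the trajectory -/

/-- The discounted reward of player `i` along the trajectory `a`, if this player stops at `s` and
the opponent at `t`. -/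
def reward (i : Fin 2) (s t : ℕ∞) (a : ℕ → E) : ℝ :=
  open Classical in
  if s < t then G.disc ^ s.toNat * G.f i (a s.toNat)
  else if t < s then G.disc ^ t.toNat * G.g i (a t.toNat)
  else if s < ⊤ then G.disc ^ s.toNat * G.h i (a s.toNat)
  else 0

theorem payoff_eq_reward (i : Fin 2) (τ : Fin 2 → Ω → ℕ∞) (ω : Ω) :
    G.payoff i τ ω = G.reward i (τ i ω) (τ i.rev ω) (G.path ω) := rfl

theorem rev_ne_self (i : Fin 2) : i.rev ≠ i := by
  fin_cases i <;> decide

theorem payoff_update (i : Fin 2) (τ : Fin 2 → Ω → ℕ∞) (σ : Ω → ℕ∞) (ω : Ω) :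
    G.payoff i (Function.update τ i σ) ω = G.reward i (σ ω) (τ i.rev ω) (G.path ω) := by
  rw [payoff_eq_reward, Function.update_self, Function.update_of_ne (rev_ne_self i)]

theorem reward_of_lt (i : Fin 2) {n : ℕ} {t : ℕ∞} (h : (n : ℕ∞) < t) (a : ℕ → E) :
    G.reward i n t a = G.disc ^ n * G.f i (a n) := by
  simp [reward, h]

theorem reward_of_gt (i : Fin 2) {n : ℕ} {s : ℕ∞} (h : (n : ℕ∞) < s) (a : ℕ → E) :
    G.reward i s n a = G.disc ^ n * G.g i (a n) := by
  simp [reward, h, h.not_gt]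

theorem reward_self (i : Fin 2) (n : ℕ) (a : ℕ → E) :
    G.reward i n n a = G.disc ^ n * G.h i (a n) := by
  simp [reward]

theorem reward_top (i : Fin 2) (a : ℕ → E) : G.reward i ⊤ ⊤ a = 0 := by
  simp [reward]

/-- Delaying both players by one step restarts the game along the shifted trajectory at the price of
one discount factor. -/
theorem reward_add_one (i : Fin 2) (s t : ℕ∞) (a : ℕ → E) :
    G.reward i (s + 1) (t + 1) a = G.disc * G.reward i s t (fun n => a (n + 1)) := by
  rcases lt_trichotomy s t with h | rfl | h
  · lift s to ℕ using h.ne_top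
    have h' : ((s + 1 : ℕ) : ℕ∞) < t + 1 := by
      push_cast
      exact (ENat.add_lt_add_iff_right (by simp)).2 h
    rw [← Nat.cast_one, ← Nat.cast_add, Nat.cast_one, G.reward_of_lt i h', G.reward_of_lt i h]
    ring
  · induction s using ENat.recTopCoe with
    | top => simp [reward_top]
    | coe s =>
      rw [← Nat.cast_one, ← Nat.cast_add, G.reward_self, G.reward_self]
      ring
  · lift t to ℕ using h.ne_top
    have h' : ((t + 1 : ℕ) : ℕ∞) < s + 1 := by
      push_cast
      exact (ENat.add_lt_add_iff_right (by simp)).2 h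
    have e : ((t : ℕ∞) + 1) = ((t + 1 : ℕ) : ℕ∞) := by push_cast; rfl
    rw [e, G.reward_of_gt i h', G.reward_of_gt i h]
    ring

theorem measurable_reward (i : Fin 2) :
    Measurable fun q : (ℕ∞ × ℕ∞) × (ℕ → E) => G.reward i q.1.1 q.1.2 q.2 := by
  -- The pairs of times form a countable space, so measurability in the trajectory for each fixed
  -- pair is enough.
  refine measurable_from_prod_countable_right fun st => ?_
  have hf := G.measurable_f i
  have hg := G.measurable_g i
  have hh := G.measurable_h i
  unfold reward
  dsimp only
  split_ifs <;> fun_prop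

/-- The supremum of all discounted rewards of player `i` along a trajectory. -/
def envelope (i : Fin 2) (a : ℕ → E) : ℝ≥0∞ :=
  ⨆ n : ℕ, ENNReal.ofReal (G.disc ^ n) * (‖G.f i (a n)‖ₑ + ‖G.g i (a n)‖ₑ + ‖G.h i (a n)‖ₑ)

/-- The bound is uniform in both times, so a single integrable function dominates the rewards of all
strategies. -/
theorem enorm_reward_le (i : Fin 2) (s t : ℕ∞) (a : ℕ → E) :
    ‖G.reward i s t a‖ₑ ≤ G.envelope i a := by
  have hd : ∀ n : ℕ, ‖G.disc ^ n‖ₑ = ENNReal.ofReal (G.disc ^ n) :=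
    fun n => Real.enorm_of_nonneg (pow_nonneg G.disc_pos.le n)
  have key : ∀ (n : ℕ) (z : ℝ), ‖z‖ₑ ≤ ‖G.f i (a n)‖ₑ + ‖G.g i (a n)‖ₑ + ‖G.h i (a n)‖ₑ →
      ‖G.disc ^ n * z‖ₑ ≤ G.envelope i a := fun n z hz => by
    rw [enorm_mul, hd]
    exact (mul_le_mul_right hz _).trans (le_iSup (fun n : ℕ => ENNReal.ofReal (G.disc ^ n) *
      (‖G.f i (a n)‖ₑ + ‖G.g i (a n)‖ₑ + ‖G.h i (a n)‖ₑ)) n)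
  unfold reward
  split_ifs
  · exact key _ _ (le_self_add.trans le_self_add)
  · exact key _ _ (le_add_self.trans le_self_add)
  · exact key _ _ le_add_self
  · simp

theorem lintegral_killedVal_enorm_lt_top (hG : G.RewardsIntegrable) (x : E) (i : Fin 2)
    {φ : E → ℝ} (hφ : φ ∈ ({G.f i, G.g i, G.h i} : Set (E → ℝ))) :
    ∫⁻ ω, ⨆ n : ℕ, G.killedVal (fun y => ‖φ y‖ₑ) n ω ∂(G.P x) < ∞ := by
  have h := hG x i φ hφ
  simp_rw [enorm_evalKilled] at h
  exact h

theorem integrable_X (x : E) {φ : E → ℝ} (hφ : Measurable φ)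
    (h : ∫⁻ ω, ⨆ n : ℕ, G.killedVal (fun y => ‖φ y‖ₑ) n ω ∂(G.P x) < ∞) (n : ℕ) :
    Integrable (fun ω => φ (G.X n ω)) (G.P x) :=
  ⟨(hφ.comp (G.measurable_X n)).aestronglyMeasurable, G.lintegral_X_lt_top x hφ.enorm h n⟩

theorem lintegral_envelope_lt_top (hG : G.RewardsIntegrable) (x : E) (i : Fin 2) :
    ∫⁻ ω, G.envelope i (G.path ω) ∂(G.P x) < ∞ := by
  have hfin : ∀ φ : E → ℝ, Measurable φ → φ ∈ ({G.f i, G.g i, G.h i} : Set (E → ℝ)) →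
      ∫⁻ ω, ⨆ n : ℕ, ENNReal.ofReal (G.disc ^ n) * ‖φ (G.X n ω)‖ₑ ∂(G.P x) < ∞ :=
    fun φ hφ h => (G.lintegral_iSup_disc_le x hφ.enorm).trans_lt
      (G.lintegral_killedVal_enorm_lt_top hG x i h)
  have hm : ∀ φ : E → ℝ, Measurable φ →
      Measurable fun ω => ⨆ n : ℕ, ENNReal.ofReal (G.disc ^ n) * ‖φ (G.X n ω)‖ₑ :=
    fun φ hφ => Measurable.iSup fun n => (hφ.comp (G.measurable_X n)).enorm.const_mul _
  refine lt_of_le_of_lt (lintegral_mono (g := fun ω =>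
      (⨆ n : ℕ, ENNReal.ofReal (G.disc ^ n) * ‖G.f i (G.X n ω)‖ₑ) +
      (⨆ n : ℕ, ENNReal.ofReal (G.disc ^ n) * ‖G.g i (G.X n ω)‖ₑ) +
      (⨆ n : ℕ, ENNReal.ofReal (G.disc ^ n) * ‖G.h i (G.X n ω)‖ₑ))
    fun ω => iSup_le fun n => ?_) ?_
  · rw [mul_add, mul_add]
    exact add_le_add (add_le_add
      (le_iSup (fun n : ℕ => ENNReal.ofReal (G.disc ^ n) * ‖G.f i (G.X n ω)‖ₑ) n)
      (le_iSup (fun n : ℕ => ENNReal.ofReal (G.disc ^ n) * ‖G.g i (G.X n ω)‖ₑ) n))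
      (le_iSup (fun n : ℕ => ENNReal.ofReal (G.disc ^ n) * ‖G.h i (G.X n ω)‖ₑ) n)
  · rw [lintegral_add_right _ (hm _ (G.measurable_h i)),
      lintegral_add_right _ (hm _ (G.measurable_g i))]
    exact ENNReal.add_lt_top.2 ⟨ENNReal.add_lt_top.2
      ⟨hfin _ (G.measurable_f i) (by simp), hfin _ (G.measurable_g i) (by simp)⟩,
      hfin _ (G.measurable_h i) (by simp)⟩

theorem integrable_reward (hG : G.RewardsIntegrable) (x : E) (i : Fin 2) {s t : Ω → ℕ∞}
    (hs : Measurable s) (ht : Measurable t) :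
    Integrable (fun ω => G.reward i (s ω) (t ω) (G.path ω)) (G.P x) :=
  ⟨((G.measurable_reward i).comp ((hs.prodMk ht).prodMk G.measurable_path)).aestronglyMeasurable,
    (lintegral_mono fun _ => G.enorm_reward_le i _ _ _).trans_lt
      (G.lintegral_envelope_lt_top hG x i)⟩

/-! ### Randomized Markov times -/

theorem enat_eq_of_forall_le_iff {s t : ℕ∞} (h : ∀ n : ℕ, s ≤ n ↔ t ≤ n) : s = t := by
  induction s using ENat.recTopCoe with
  | top =>
    induction t using ENat.recTopCoe with
    | top => rfl
    | coe t => simpa using (h t).2 le_rfl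
  | coe s =>
    induction t using ENat.recTopCoe with
    | top => simpa using (h s).1 le_rfl
    | coe t => exact le_antisymm ((h t).2 le_rfl) ((h s).1 le_rfl)

/-- The randomized Markov time of player `i` as a functional of the trajectories. -/
def thresholdTime (p : Fin 2 → E → ℝ) (i : Fin 2) (a : ℕ → E) (u : Fin 2 × ℕ → ℝ) : ℕ∞ :=
  sInf {t : ℕ∞ | ∃ n : ℕ, t = n ∧ p i (a n) ≥ u (i, n)}

theorem markovTime_eq_thresholdTime (p : Fin 2 → E → ℝ) (i : Fin 2) (ω : Ω) :
    G.markovTime p i ω = thresholdTime p i (G.path ω) (G.noise ω) := rfl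

theorem thresholdTime_le_iff {S : Type*} (p : Fin 2 → S → ℝ) (i : Fin 2) (a : ℕ → S)
    (u : Fin 2 × ℕ → ℝ)
    (n : ℕ) : thresholdTime p i a u ≤ n ↔ ∃ k ≤ n, u (i, k) ≤ p i (a k) := by
  constructor
  · intro h
    have hne : {t : ℕ∞ | ∃ n : ℕ, t = n ∧ p i (a n) ≥ u (i, n)}.Nonempty := by
      by_contra hne
      rw [not_nonempty_iff_eq_empty] at hne
      rw [thresholdTime, hne] at h
      simp at h
    obtain ⟨k, hk, hk'⟩ := csInf_mem hne
    refine ⟨k, ?_, hk'⟩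
    have h' : ((k : ℕ) : ℕ∞) ≤ n := hk ▸ h
    exact_mod_cast h'
  · rintro ⟨k, hk, hk'⟩
    exact (csInf_le' (show (k : ℕ∞) ∈ {t : ℕ∞ | ∃ n : ℕ, t = n ∧ p i (a n) ≥ u (i, n)} from
      ⟨k, rfl, hk'⟩)).trans (Nat.cast_le.2 hk)

theorem lt_thresholdTime_iff {S : Type*} (p : Fin 2 → S → ℝ) (i : Fin 2) (a : ℕ → S)
    (u : Fin 2 × ℕ → ℝ)
    (n : ℕ) : (n : ℕ∞) < thresholdTime p i a u ↔ ∀ k ≤ n, p i (a k) < u (i, k) := by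
  rw [← not_le, thresholdTime_le_iff]
  push Not
  rfl

theorem le_thresholdTime_iff {S : Type*} (p : Fin 2 → S → ℝ) (i : Fin 2) (a : ℕ → S)
    (u : Fin 2 × ℕ → ℝ)
    (n : ℕ) : (n : ℕ∞) ≤ thresholdTime p i a u ↔ ∀ k < n, p i (a k) < u (i, k) := by
  rcases n with _ | n
  · simp
  · rw [Nat.cast_add, Nat.cast_one, ENat.add_one_le_iff (ENat.natCast_ne_top n),
      lt_thresholdTime_iff]
    simp only [Nat.lt_succ_iff]

theorem thresholdTime_eq_zero {S : Type*} (p : Fin 2 → S → ℝ) (i : Fin 2) {a : ℕ → S}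
    {u : Fin 2 × ℕ → ℝ}
    (h : u (i, 0) ≤ p i (a 0)) : thresholdTime p i a u = 0 := by
  have := (thresholdTime_le_iff p i a u 0).2 ⟨0, le_rfl, h⟩
  simpa using this

/-- A randomized Markov time that does not stop at 0 starts afresh on the shifted sequences. -/
theorem thresholdTime_eq_add_one {S : Type*} (p : Fin 2 → S → ℝ) (i : Fin 2) {a : ℕ → S}
    {u : Fin 2 × ℕ → ℝ} (h : ¬ u (i, 0) ≤ p i (a 0)) :
    thresholdTime p i a u =
      thresholdTime p i (fun n => a (n + 1)) (fun k => u (k.1, k.2 + 1)) + 1 := by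
  refine enat_eq_of_forall_le_iff fun n => ?_
  rw [thresholdTime_le_iff]
  rcases n with _ | n
  · simpa using h
  · rw [Nat.cast_add, Nat.cast_one, ENat.add_le_add_iff_right (by simp), thresholdTime_le_iff]
    constructor
    · rintro ⟨_ | k, hk, hk'⟩
      exacts [absurd hk' h, ⟨k, by omega, hk'⟩]
    · rintro ⟨k, hk, hk'⟩
      exact ⟨k + 1, by omega, hk'⟩

theorem measurableSet_thresholdTime_le {α : Type*} {m : MeasurableSpace α} {p : Fin 2 → E → ℝ}
    (hp : ∀ i, Measurable (p i)) (i : Fin 2) {a : α → ℕ → E} {u : α → Fin 2 × ℕ → ℝ} (n : ℕ)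
    (ha : ∀ k ≤ n, Measurable[m] fun ω => a ω k)
    (hu : ∀ k ≤ n, Measurable[m] fun ω => u ω (i, k)) :
    MeasurableSet[m] {ω | thresholdTime p i (a ω) (u ω) ≤ n} := by
  have e : {ω | thresholdTime p i (a ω) (u ω) ≤ n} =
      ⋃ k, ⋃ (_ : k ≤ n), {ω | u ω (i, k) ≤ p i (a ω k)} := by
    ext ω
    simp [thresholdTime_le_iff]
  rw [e]
  exact MeasurableSet.iUnion fun k => MeasurableSet.iUnion fun hk =>
    measurableSet_le (hu k hk) ((hp i).comp (ha k hk))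

theorem measurable_of_measurableSet_le {α : Type*} {m : MeasurableSpace α} {s : α → ℕ∞}
    (h : ∀ n : ℕ, MeasurableSet[m] {ω | s ω ≤ n}) : Measurable[m] s := by
  have hlt : ∀ n : ℕ, MeasurableSet[m] {ω | s ω < n} := fun n => by
    rcases n with _ | n
    · simp
    · convert! h n using 3
      rw [Nat.cast_add, Nat.cast_one, ENat.lt_add_one_iff (ENat.natCast_ne_top n)]
  refine measurable_to_countable' fun t => ?_
  induction t using ENat.recTopCoe with
  | top =>
    have e : s ⁻¹' {⊤} = (⋃ n : ℕ, {ω | s ω ≤ n})ᶜ := by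
      ext ω
      simp only [mem_preimage, mem_singleton_iff, mem_compl_iff, mem_iUnion, mem_ofPred_eq,
        not_exists]
      constructor
      · intro h n
        simp [h]
      · intro h
        by_contra h'
        lift s ω to ℕ using h' with k
        exact h k le_rfl
    rw [e]
    exact (MeasurableSet.iUnion h).compl
  | coe n =>
    have e : s ⁻¹' {(n : ℕ∞)} = {ω | s ω ≤ n} \ {ω | s ω < n} := by
      ext ω
      simp only [mem_preimage, mem_singleton_iff, Set.mem_sdiff, mem_ofPred_eq, not_lt]
      exact ⟨fun h => ⟨h.le, h.ge⟩, fun h => le_antisymm h.1 h.2⟩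
    rw [e]
    exact MeasurableSet.diff (h n) (hlt n)

theorem measurable_thresholdTime {α : Type*} {m : MeasurableSpace α} {p : Fin 2 → E → ℝ}
    (hp : ∀ i, Measurable (p i)) (i : Fin 2) {a : α → ℕ → E} {u : α → Fin 2 × ℕ → ℝ}
    (ha : ∀ k, Measurable[m] fun ω => a ω k) (hu : ∀ k, Measurable[m] fun ω => u ω (i, k)) :
    Measurable[m] fun ω => thresholdTime p i (a ω) (u ω) :=
  measurable_of_measurableSet_le fun n =>
    measurableSet_thresholdTime_le hp i n (fun k _ => ha k) fun k _ => hu k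

theorem measurable_X_info (i : Fin 2) {k n : ℕ} (h : k ≤ n) : Measurable[G.info i n] (G.X k) :=
  Measurable.of_comap_le (le_iSup₂_of_le (f := fun k (_ : k ≤ n) =>
    MeasurableSpace.comap (G.X k) inferInstance ⊔
      MeasurableSpace.comap (G.ξ i k) inferInstance) k h le_sup_left)

theorem measurable_ξ_info (i : Fin 2) {k n : ℕ} (h : k ≤ n) :
    Measurable[G.info i n] (G.ξ i k) :=
  Measurable.of_comap_le (le_iSup₂_of_le (f := fun k (_ : k ≤ n) =>
    MeasurableSpace.comap (G.X k) inferInstance ⊔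
      MeasurableSpace.comap (G.ξ i k) inferInstance) k h le_sup_right)

theorem admissible_markovTime {p : Fin 2 → E → ℝ} (hp : ∀ i, Measurable (p i)) (i : Fin 2) :
    G.Admissible i (G.markovTime p i) := fun n =>
  measurableSet_thresholdTime_le hp i (a := G.path) (u := G.noise) n
    (fun _ hk => G.measurable_X_info i hk) fun _ hk => G.measurable_ξ_info i hk

theorem Admissible.measurable {G : MarkovDynkinGame E Ω}
    {i : Fin 2} {σ : Ω → ℕ∞} (h : G.Admissible i σ) : Measurable σ :=
  measurable_of_measurableSet_le fun n => (G.info i).le n _ (h n)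

/-! ### Averaging over a randomization device -/

/-- Apply `setIntegral_ξ_le` to both branches, obtaining the second one by subtraction from the full
integral. Nothing except the comparison itself may see device `k`. -/
theorem setIntegral_ite_ξ (x : E) (k : Fin 2 × ℕ) {A : Set Ω} (hA : MeasurableSet[G.others k] A)
    {Z₁ Z₂ a : Ω → ℝ} (hZ₁ : Measurable[G.others k] Z₁) (hZ₂ : Measurable[G.others k] Z₂)
    (hi₁ : Integrable Z₁ (G.P x)) (hi₂ : Integrable Z₂ (G.P x))
    (ha : Measurable[G.others k] a) (ha01 : ∀ ω, a ω ∈ Icc (0 : ℝ) 1) :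
    ∫ ω in A, (open Classical in if G.ξ k.1 k.2 ω ≤ a ω then Z₁ ω else Z₂ ω) ∂(G.P x) =
      ∫ ω in A, (a ω * Z₁ ω + (1 - a ω) * Z₂ ω) ∂(G.P x) := by
  classical
  have hA' := G.others_le k A hA
  have ha' := ha.mono (G.others_le k) le_rfl
  set S := {ω | G.ξ k.1 k.2 ω ≤ a ω} with hS
  have hSm : MeasurableSet S := measurableSet_le (G.measurable_ξ k.1 k.2) ha'
  have hj₁ := hi₁.indicator hA'
  have hj₂ := hi₂.indicator hA'
  have e₁ := G.setIntegral_ξ_le x k (hZ₁.indicator hA) hj₁ ha ha01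
  have e₂ := G.setIntegral_ξ_le x k (hZ₂.indicator hA) hj₂ ha ha01
  have e₃ := integral_add_compl hSm hj₂
  have hb : ∀ Z : Ω → ℝ, Integrable Z (G.P x) → Integrable (fun ω => a ω * Z ω) (G.P x) :=
    fun Z hZ => hZ.bdd_mul (c := 1) ha'.aestronglyMeasurable (ae_of_all _ fun ω => by
      rw [Real.norm_of_nonneg (ha01 ω).1]
      exact (ha01 ω).2)
  rw [← integral_indicator hA', ← integral_indicator hA']
  calc ∫ ω, A.indicator (fun ω => if G.ξ k.1 k.2 ω ≤ a ω then Z₁ ω else Z₂ ω) ω ∂(G.P x)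
      = ∫ ω, (S.indicator (A.indicator Z₁) ω + Sᶜ.indicator (A.indicator Z₂) ω) ∂(G.P x) := by
        refine integral_congr_ae (ae_of_all _ fun ω => ?_)
        by_cases h1 : ω ∈ A <;> by_cases h2 : G.ξ k.1 k.2 ω ≤ a ω <;>
          simp [indicator, hS, h1, h2]
    _ = ∫ ω in S, A.indicator Z₁ ω ∂(G.P x) + ∫ ω in Sᶜ, A.indicator Z₂ ω ∂(G.P x) := by
        rw [integral_add (hj₁.indicator hSm) (hj₂.indicator hSm.compl), integral_indicator hSm,
          integral_indicator hSm.compl]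
    _ = ∫ ω, a ω * A.indicator Z₁ ω ∂(G.P x) +
          (∫ ω, A.indicator Z₂ ω ∂(G.P x) - ∫ ω, a ω * A.indicator Z₂ ω ∂(G.P x)) := by
        rw [e₁, ← e₂]
        linarith
    _ = ∫ ω, (a ω * A.indicator Z₁ ω +
          (A.indicator Z₂ ω - a ω * A.indicator Z₂ ω)) ∂(G.P x) := by
        rw [← integral_sub hj₂ (hb _ hj₂)]
        exact (integral_add (hb _ hj₁) (hj₂.sub (hb _ hj₂))).symm
    _ = _ := by
        refine integral_congr_ae (ae_of_all _ fun ω => ?_)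
        by_cases h1 : ω ∈ A
        · simp [indicator, h1]
          ring
        · simp [indicator, h1]

theorem measurable_stopValue {p : Fin 2 → E → ℝ} (hp : ∀ i, Measurable (p i)) (i : Fin 2) :
    Measurable (G.stopValue p i) :=
  (((hp i.rev).const_sub 1).mul (G.measurable_f i)).add ((hp i.rev).mul (G.measurable_h i))

/-! ### Necessity of the Wald-Bellman system -/

/-- The strategy of not stopping at time `0` and using the randomized Markov time afterwards. -/
def delayedTime (p : Fin 2 → E → ℝ) (i : Fin 2) (ω : Ω) : ℕ∞ :=
  thresholdTime p i (G.pathTail ω) (G.noiseTail ω) + 1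

theorem markovTime_eq_zero {p : Fin 2 → E → ℝ} {i : Fin 2} {ω : Ω}
    (h : G.ξ i 0 ω ≤ p i (G.X 0 ω)) : G.markovTime p i ω = 0 :=
  thresholdTime_eq_zero p i (a := G.path ω) (u := G.noise ω) h

theorem markovTime_eq_delayedTime {p : Fin 2 → E → ℝ} {i : Fin 2} {ω : Ω}
    (h : ¬ G.ξ i 0 ω ≤ p i (G.X 0 ω)) : G.markovTime p i ω = G.delayedTime p i ω :=
  thresholdTime_eq_add_one p i (a := G.path ω) (u := G.noise ω) h

theorem admissible_delayedTime {p : Fin 2 → E → ℝ} (hp : ∀ i, Measurable (p i)) (i : Fin 2) :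
    G.Admissible i (G.delayedTime p i) := by
  rintro (_ | n)
  · convert! @MeasurableSet.empty _ (G.info i 0)
    ext ω
    refine iff_of_false (fun h => ?_) (notMem_empty ω)
    have h' : thresholdTime p i (G.pathTail ω) (G.noiseTail ω) + 1 ≤ (0 : ℕ∞) := h
    simp at h'
  · have e : {ω | G.delayedTime p i ω ≤ ((n + 1 : ℕ) : ℕ∞)} =
        {ω | thresholdTime p i (G.pathTail ω) (G.noiseTail ω) ≤ n} := by
      ext ω
      simp only [delayedTime, mem_ofPred_eq]
      rw [Nat.cast_add, Nat.cast_one, ENat.add_le_add_iff_right (by simp)]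
    refine e ▸ measurableSet_thresholdTime_le hp i n (fun k hk => ?_) fun k hk => ?_
    · exact G.measurable_X_info i (Nat.succ_le_succ hk)
    · exact G.measurable_ξ_info i (Nat.succ_le_succ hk)

theorem measurable_markovTime_others {p : Fin 2 → E → ℝ} (hp : ∀ i, Measurable (p i))
    {i : Fin 2} {k : Fin 2 × ℕ} (h : i ≠ k.1) : Measurable[G.others k] (G.markovTime p i) :=
  measurable_thresholdTime hp i (a := G.path) (u := G.noise) (fun n => G.measurable_X_others k n)
    fun n => G.measurable_ξ_others (l := (i, n)) fun e => h (congrArg Prod.fst e)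

/-- The shifted time reads devices only from time 1 on, so it is blind to either player's device at
time 0. -/
theorem measurable_tailTime_others {p : Fin 2 → E → ℝ} (hp : ∀ i, Measurable (p i))
    (i j : Fin 2) : Measurable[G.others (j, 0)]
      fun ω => thresholdTime p i (G.pathTail ω) (G.noiseTail ω) :=
  measurable_thresholdTime hp i (fun n => G.measurable_X_others _ (n + 1))
    fun n => G.measurable_ξ_others (l := (i, n + 1)) (k := (j, 0)) (by simp)

theorem measurable_reward_comp {α : Type*} {m : MeasurableSpace α} (i : Fin 2) {s t : α → ℕ∞}
    {a : α → ℕ → E} (hs : Measurable s) (ht : Measurable t) (ha : Measurable a) :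
    Measurable fun ω => G.reward i (s ω) (t ω) (a ω) :=
  (G.measurable_reward i).comp ((hs.prodMk ht).prodMk ha)

theorem measurable_pathTail_others (k : Fin 2 × ℕ) : Measurable[G.others k] G.pathTail :=
  @measurable_pi_lambda _ _ _ (G.others k) _ _ fun n => G.measurable_X_others k (n + 1)

theorem integrable_X_of_mem (hG : G.RewardsIntegrable) (x : E) (i : Fin 2) {φ : E → ℝ}
    (hm : Measurable φ) (h : φ ∈ ({G.f i, G.g i, G.h i} : Set (E → ℝ))) (n : ℕ) :
    Integrable (fun ω => φ (G.X n ω)) (G.P x) :=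
  G.integrable_X x hm (G.lintegral_killedVal_enorm_lt_top hG x i h) n

/-- The expected reward of player `i` from stopping at time `0`. -/
theorem J_update_zero (hG : G.RewardsIntegrable) {p : Fin 2 → E → ℝ}
    (hp : ∀ i, Measurable (p i)) (hp01 : ∀ i x, p i x ∈ Icc (0 : ℝ) 1) (i : Fin 2) (x : E) :
    G.J i x (Function.update (G.markovTime p) i fun _ => 0) = G.stopValue p i x := by
  classical
  have h := G.setIntegral_ite_ξ x (i.rev, 0) MeasurableSet.univ
    (Z₁ := fun ω => G.h i (G.X 0 ω)) (Z₂ := fun ω => G.f i (G.X 0 ω))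
    (a := fun ω => p i.rev (G.X 0 ω))
    ((G.measurable_h i).comp (G.measurable_X_others _ 0))
    ((G.measurable_f i).comp (G.measurable_X_others _ 0))
    (G.integrable_X_of_mem hG x i (G.measurable_h i) (by simp) 0)
    (G.integrable_X_of_mem hG x i (G.measurable_f i) (by simp) 0)
    ((hp _).comp (G.measurable_X_others _ 0)) (fun ω => hp01 _ _)
  simp only [Measure.restrict_univ] at h
  calc G.J i x (Function.update (G.markovTime p) i fun _ => 0)
      = ∫ ω, (if G.ξ i.rev 0 ω ≤ p i.rev (G.X 0 ω) then G.h i (G.X 0 ω) else G.f i (G.X 0 ω))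
          ∂(G.P x) := by
        refine integral_congr_ae (ae_of_all _ fun ω => ?_)
        dsimp only
        rw [payoff_update]
        split_ifs with hω
        · rw [G.markovTime_eq_zero hω]
          simpa using! G.reward_self i 0 (G.path ω)
        · rw [G.markovTime_eq_delayedTime hω]
          simpa using! G.reward_of_lt i (n := 0) (t := G.delayedTime p i.rev ω)
            (by simp [delayedTime]) (G.path ω)
    _ = ∫ ω, G.stopValue p i x ∂(G.P x) := by
        refine h.trans (integral_congr_ae ?_)
        filter_upwards [G.ae_X_zero x (G.measurable_stopValue hp i)] with ω hω
        rw [← hω, stopValue]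
        ring
    _ = G.stopValue p i x := by simp

/-- The values are integrable with respect to the transition kernel, and `contValue` is the
expected reward of player `i` from not stopping at time `0`. -/
theorem J_update_delayedTime (hG : G.RewardsIntegrable) {p V : Fin 2 → E → ℝ}
    (hp : ∀ i, Measurable (p i)) (hp01 : ∀ i x, p i x ∈ Icc (0 : ℝ) 1)
    (hV : G.HasValues p V) (i : Fin 2) (x : E) :
    Integrable (V i) (G.kern x) ∧
      G.J i x (Function.update (G.markovTime p) i (G.delayedTime p i)) = G.contValue p V i x := by
  classical
  set F : (ℕ → E) × (Fin 2 × ℕ → ℝ) → ℝ := fun q =>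
    G.reward i (thresholdTime p i q.1 q.2) (thresholdTime p i.rev q.1 q.2) q.1 with hF
  have hT : ∀ j, Measurable fun q : (ℕ → E) × (Fin 2 × ℕ → ℝ) => thresholdTime p j q.1 q.2 :=
    fun j => measurable_thresholdTime hp j
      (fun k => (measurable_pi_apply k).comp measurable_fst)
      fun k => (measurable_pi_apply (j, k)).comp measurable_snd
  have hFm : Measurable F := G.measurable_reward_comp i (hT i) (hT i.rev) measurable_fst
  have hVF : ∀ y, V i y = ∫ ω, F (G.path ω, G.noise ω) ∂(G.P y) := fun y => hV i y
  have hdel : ∀ ω, G.reward i (G.delayedTime p i ω) (G.delayedTime p i.rev ω) (G.path ω) =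
      G.disc * F (G.pathTail ω, G.noiseTail ω) := fun ω => G.reward_add_one i _ _ _
  -- When both players are delayed the reward is `disc` times the shifted functional; dividing by
  -- `disc` transfers integrability.
  have hint : Integrable (fun ω => F (G.pathTail ω, G.noiseTail ω)) (G.P x) := by
    have h := G.integrable_reward hG x i (G.admissible_delayedTime hp i).measurable
      (G.admissible_delayedTime hp i.rev).measurable
    simp_rw [hdel] at h
    simpa [← mul_assoc, inv_mul_cancel₀ G.disc_pos.ne'] using h.const_mul G.disc⁻¹
  obtain ⟨h1, h2⟩ := G.integral_tail x hFm hint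
  simp_rw [← hVF] at h1 h2
  refine ⟨h1, ?_⟩
  have hFo : Measurable[G.others (i.rev, 0)] fun ω => F (G.pathTail ω, G.noiseTail ω) :=
    G.measurable_reward_comp i (G.measurable_tailTime_others hp i i.rev)
      (G.measurable_tailTime_others hp i.rev i.rev) (G.measurable_pathTail_others _)
  -- The opponent's device at time 0 decides: either the opponent stops now and pays `g`, or both
  -- players enter the shifted game.
  have h := G.setIntegral_ite_ξ x (i.rev, 0) MeasurableSet.univ
    (Z₁ := fun ω => G.g i (G.X 0 ω)) (Z₂ := fun ω => G.disc * F (G.pathTail ω, G.noiseTail ω))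
    (a := fun ω => p i.rev (G.X 0 ω))
    ((G.measurable_g i).comp (G.measurable_X_others _ 0)) (hFo.const_mul _)
    (G.integrable_X_of_mem hG x i (G.measurable_g i) (by simp) 0) (hint.const_mul _)
    ((hp _).comp (G.measurable_X_others _ 0)) (fun ω => hp01 _ _)
  simp only [Measure.restrict_univ] at h
  calc G.J i x (Function.update (G.markovTime p) i (G.delayedTime p i))
      = ∫ ω, (if G.ξ i.rev 0 ω ≤ p i.rev (G.X 0 ω) then G.g i (G.X 0 ω) else
          G.disc * F (G.pathTail ω, G.noiseTail ω)) ∂(G.P x) := by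
        refine integral_congr_ae (ae_of_all _ fun ω => ?_)
        dsimp only
        rw [payoff_update]
        split_ifs with hω
        · rw [G.markovTime_eq_zero hω]
          simpa using! G.reward_of_gt i (n := 0) (s := G.delayedTime p i ω)
            (by simp [delayedTime]) (G.path ω)
        · rw [G.markovTime_eq_delayedTime hω, hdel]
    _ = ∫ ω, (p i.rev x * G.g i x +
          (1 - p i.rev x) * (G.disc * F (G.pathTail ω, G.noiseTail ω))) ∂(G.P x) := by
        refine h.trans (integral_congr_ae ?_)
        filter_upwards [G.ae_X_zero x (G.measurable_g i), G.ae_X_zero x (hp i.rev)] with ω h1 h2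
        rw [h1, h2]
    _ = G.contValue p V i x := by
        rw [integral_add (integrable_const _) ((hint.const_mul _).const_mul _),
          integral_const_mul, integral_const_mul, integral_const_mul, h2, contValue]
        simp only [integral_const, probReal_univ, smul_eq_mul, one_mul]
        ring

/-- Conditioning on the own randomization device at time `0`. -/
theorem J_markovTime_eq (hG : G.RewardsIntegrable) {p : Fin 2 → E → ℝ}
    (hp : ∀ i, Measurable (p i)) (hp01 : ∀ i x, p i x ∈ Icc (0 : ℝ) 1) (i : Fin 2) (x : E) :
    G.J i x (G.markovTime p) =
      p i x * G.J i x (Function.update (G.markovTime p) i fun _ => 0) +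
        (1 - p i x) * G.J i x (Function.update (G.markovTime p) i (G.delayedTime p i)) := by
  classical
  -- The own device at time 0 affects neither the opponent's time nor the own delayed time, so it
  -- can be averaged out between the two deviations.
  have hτ := G.measurable_markovTime_others hp (k := (i, 0)) (rev_ne_self i)
  have hτ' := (G.admissible_markovTime hp i.rev).measurable
  have hi₀ := G.integrable_reward hG x i (s := fun _ => 0) measurable_const hτ'
  have hi₁ := G.integrable_reward hG x i (G.admissible_delayedTime hp i).measurable hτ'
  have hσ : Measurable[G.others (i, 0)] (G.delayedTime p i) :=
    (Measurable.of_discrete (f := fun t : ℕ∞ => t + 1)).comp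
      (G.measurable_tailTime_others hp i i)
  have h := G.setIntegral_ite_ξ x (i, 0) MeasurableSet.univ
    (a := fun ω => p i (G.X 0 ω))
    (G.measurable_reward_comp i (@measurable_const _ _ _ (G.others (i, 0)) 0) hτ
      (G.measurable_path_others _))
    (G.measurable_reward_comp i hσ hτ (G.measurable_path_others _))
    hi₀ hi₁ ((hp _).comp (G.measurable_X_others _ 0)) (fun ω => hp01 _ _)
  simp only [Measure.restrict_univ] at h
  have e : ∀ σ, G.J i x (Function.update (G.markovTime p) i σ) =
      ∫ ω, G.reward i (σ ω) (G.markovTime p i.rev ω) (G.path ω) ∂(G.P x) := fun σ =>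
    integral_congr_ae (ae_of_all _ fun ω => G.payoff_update i _ σ ω)
  rw [e, e, ← integral_const_mul, ← integral_const_mul,
    ← integral_add (hi₀.const_mul _) (hi₁.const_mul _)]
  refine Eq.trans (integral_congr_ae (ae_of_all _ fun ω => ?_)) (h.trans (integral_congr_ae ?_))
  · rw [payoff_eq_reward]
    split_ifs with hω
    · rw [G.markovTime_eq_zero hω]
    · rw [G.markovTime_eq_delayedTime hω]
  · filter_upwards [G.ae_X_zero x (hp i)] with ω hω
    rw [hω]

/-- With `s` the stopping value and `c` the continuation value, `V = p s + (1 - p) c` while `s ≤ V`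
and `c ≤ V`. Thus `V` is their maximum, `c ≤ V` gives `p (s - c) ≥ 0`, and `s ≤ V` gives `(1 - p) (c
- s) ≥ 0`. -/
theorem waldBellmanSystem_of_isGlobalEquilibrium (hG : G.RewardsIntegrable)
    {p V : Fin 2 → E → ℝ} (hp : ∀ i, Measurable (p i)) (hp01 : ∀ i x, p i x ∈ Icc (0 : ℝ) 1)
    (he : G.IsGlobalEquilibrium p) (hV : G.HasValues p V) : G.WaldBellmanSystem p V := by
  intro i x
  have hs := G.J_update_zero hG hp hp01 i x
  obtain ⟨-, hc⟩ := G.J_update_delayedTime hG hp hp01 hV i x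
  have hJ := G.J_markovTime_eq hG hp hp01 i x
  have hub := ((he x).2 i).1
  have hs' : G.stopValue p i x ≤ V i x := by
    rw [hV i x, ← hs]
    exact hub ⟨_, isStoppingTime_const (G.info i) 0, rfl⟩
  have hc' : G.contValue p V i x ≤ V i x := by
    rw [hV i x, ← hc]
    exact hub ⟨_, G.admissible_delayedTime hp i, rfl⟩
  rw [← hV i x, hs, hc] at hJ
  obtain ⟨h0, h1⟩ := hp01 i x
  refine ⟨le_antisymm ?_ (max_le hc' hs'), fun hpos => ?_, fun hlt => ?_⟩
  · rw [hJ]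
    nlinarith [le_max_left (G.contValue p V i x) (G.stopValue p i x),
      le_max_right (G.contValue p V i x) (G.stopValue p i x)]
  · nlinarith
  · nlinarith

/-! ### Sufficiency of the Wald-Bellman system -/

/-- The event that neither of two times is before `n`. -/
def running {α : Type*} (σ τ : α → ℕ∞) (n : ℕ) : Set α := {ω | (n : ℕ∞) ≤ σ ω ∧ (n : ℕ∞) ≤ τ ω}

theorem Admissible.measurableSet_lt {G : MarkovDynkinGame E Ω}
    {i : Fin 2} {σ : Ω → ℕ∞} (h : G.Admissible i σ) (n : ℕ) :
    MeasurableSet[G.info i n] {ω | (n : ℕ∞) < σ ω} := by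
  convert! (h n).compl using 1
  ext ω
  exact (not_le (a := σ ω) (b := (n : ℕ∞))).symm

theorem Admissible.measurableSet_le {G : MarkovDynkinGame E Ω}
    {i : Fin 2} {σ : Ω → ℕ∞} (h : G.Admissible i σ) (n : ℕ) :
    MeasurableSet[G.info i n] {ω | (n : ℕ∞) ≤ σ ω} := by
  rcases n with _ | n
  · simp
  · convert! (G.info i).mono n.le_succ _ (h.measurableSet_lt n) using 1
    ext ω
    simp only [mem_ofPred_eq]
    rw [Nat.cast_add, Nat.cast_one, ENat.add_one_le_iff (ENat.natCast_ne_top n)]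

/-- Not having stopped before `n` involves devices strictly earlier than `n`, so the device at `n`
is still fresh. -/
theorem measurableSet_le_markovTime_others {p : Fin 2 → E → ℝ} (hp : ∀ i, Measurable (p i))
    (i : Fin 2) (n : ℕ) : MeasurableSet[G.others (i, n)] {ω | (n : ℕ∞) ≤ G.markovTime p i ω} := by
  have e : {ω | (n : ℕ∞) ≤ G.markovTime p i ω} =
      ⋂ k, ⋂ (_ : k < n), {ω | p i (G.X k ω) < G.ξ i k ω} := by
    ext ω
    rw [mem_ofPred_eq, markovTime_eq_thresholdTime, le_thresholdTime_iff]
    simp [path, noise]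
  rw [e]
  refine MeasurableSet.iInter fun k => MeasurableSet.iInter fun hk => _root_.measurableSet_lt
    ((hp i).comp (G.measurable_X_others _ k)) (G.measurable_ξ_others (l := (i, k)) ?_)
  simp [hk.ne]

theorem integrable_mul_X {x : E} {n : ℕ} {q : E → ℝ} (hq : Measurable q)
    (hq01 : ∀ y, q y ∈ Icc (0 : ℝ) 1) {Z : Ω → ℝ} (hZ : Integrable Z (G.P x)) :
    Integrable (fun ω => q (G.X n ω) * Z ω) (G.P x) :=
  hZ.bdd_mul (c := 1) (hq.comp (G.measurable_X n)).aestronglyMeasurable (ae_of_all _ fun ω => by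
    rw [Real.norm_of_nonneg (hq01 _).1]
    exact (hq01 _).2)

theorem one_sub_mem_Icc {r : ℝ} (h : r ∈ Icc (0 : ℝ) 1) : 1 - r ∈ Icc (0 : ℝ) 1 :=
  ⟨sub_nonneg.2 h.2, sub_le_self 1 h.1⟩

theorem integrable_stopValue_X (hG : G.RewardsIntegrable) {p : Fin 2 → E → ℝ}
    (hp : ∀ i, Measurable (p i)) (hp01 : ∀ i x, p i x ∈ Icc (0 : ℝ) 1) (i : Fin 2) (x : E)
    (n : ℕ) : Integrable (fun ω => G.stopValue p i (G.X n ω)) (G.P x) :=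
  (G.integrable_mul_X ((hp i.rev).const_sub 1) (fun y => one_sub_mem_Icc (hp01 _ y))
    (G.integrable_X_of_mem hG x i (G.measurable_f i) (by simp) n)).add
      (G.integrable_mul_X (hp i.rev) (hp01 i.rev)
        (G.integrable_X_of_mem hG x i (G.measurable_h i) (by simp) n))

theorem integrable_contValue_X (hG : G.RewardsIntegrable) {p V : Fin 2 → E → ℝ}
    (hp : ∀ i, Measurable (p i)) (hp01 : ∀ i x, p i x ∈ Icc (0 : ℝ) 1)
    (hV : ∀ i, Measurable (V i)) (i : Fin 2) (x : E) (n : ℕ)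
    (hVi : Integrable (fun ω => V i (G.X (n + 1) ω)) (G.P x)) :
    Integrable (fun ω => G.contValue p V i (G.X n ω)) (G.P x) :=
  (G.integrable_mul_X ((hp i.rev).const_sub 1) (fun y => one_sub_mem_Icc (hp01 _ y))
    ((G.integrable_kern_X x n (hV i) hVi).const_mul G.disc)).add
      (G.integrable_mul_X (hp i.rev) (hp01 i.rev)
        (G.integrable_X_of_mem hG x i (G.measurable_g i) (by simp) n))

/-- The one-step decomposition of the reward of player `i` with continuation function `V i`,
when the opponent uses a randomized Markov time. -/
theorem setIntegral_running_step (hG : G.RewardsIntegrable) {p V : Fin 2 → E → ℝ}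
    (hp : ∀ i, Measurable (p i)) (hp01 : ∀ i x, p i x ∈ Icc (0 : ℝ) 1)
    (hV : ∀ i, Measurable (V i)) (i : Fin 2) (x : E)
    (hVi : ∀ n, Integrable (fun ω => V i (G.X n ω)) (G.P x))
    {σ : Ω → ℕ∞} (hσ : G.Admissible i σ) (n : ℕ) :
    ∫ ω in running σ (G.markovTime p i.rev) n \ running σ (G.markovTime p i.rev) (n + 1),
        G.reward i (σ ω) (G.markovTime p i.rev ω) (G.path ω) ∂(G.P x) +
      G.disc ^ (n + 1) * ∫ ω in running σ (G.markovTime p i.rev) (n + 1),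
        V i (G.X (n + 1) ω) ∂(G.P x) =
    G.disc ^ n * ∫ ω in running σ (G.markovTime p i.rev) n,
      (open Classical in if σ ω = n then G.stopValue p i (G.X n ω)
        else G.contValue p V i (G.X n ω)) ∂(G.P x) := by
  classical
  set j := i.rev with hj
  set τ := G.markovTime p j with hτ
  have hij : i ≠ j := (rev_ne_self i).symm
  have hτA : G.Admissible j τ := G.admissible_markovTime hp j
  have hWo : MeasurableSet[G.others (j, n)] (running σ τ n) :=
    MeasurableSet.inter (G.info_le_others hij n n _ (hσ.measurableSet_le n))
      (G.measurableSet_le_markovTime_others hp j n)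
  have hWm := G.others_le _ _ hWo
  have hW' : running σ τ (n + 1) = {ω | (n : ℕ∞) < σ ω} ∩ {ω | (n : ℕ∞) < τ ω} := by
    ext ω
    simp only [running, mem_ofPred_eq, mem_inter_iff]
    rw [Nat.cast_add, Nat.cast_one, ENat.add_one_le_iff (ENat.natCast_ne_top n),
      ENat.add_one_le_iff (ENat.natCast_ne_top n)]
  have hWp : MeasurableSet[G.pastNoise n] (running σ τ (n + 1)) := by
    rw [hW']
    exact MeasurableSet.inter (G.info_le_pastNoise i n _ (hσ.measurableSet_lt n))
      (G.info_le_pastNoise j n _ (hτA.measurableSet_lt n))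
  have hWm' := G.pastNoise_le n _ hWp
  have hsub : running σ τ (n + 1) ⊆ running σ τ n := by
    rw [hW']
    exact fun ω h => ⟨le_of_lt h.1, le_of_lt h.2⟩
  have hσo : MeasurableSet[G.others (j, n)] {ω | σ ω = n} := by
    have e : {ω | σ ω = n} = {ω | σ ω ≤ n} ∩ {ω | (n : ℕ∞) ≤ σ ω} := by
      ext ω
      exact le_antisymm_iff
    rw [e]
    exact G.info_le_others hij n n _ ((hσ n).inter (hσ.measurableSet_le n))
  have hσm := G.others_le _ _ hσo
  set C : E → ℝ := fun y => ∫ z, V i z ∂(G.kern y) with hC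
  have hCm : Measurable C := (hV i).stronglyMeasurable.integral_kernel.measurable
  have hCi : Integrable (fun ω => C (G.X n ω)) (G.P x) :=
      G.integrable_kern_X x n (hV i) (hVi (n + 1))
  have hmem : ∀ φ, Measurable φ → φ ∈ ({G.f i, G.g i, G.h i} : Set (E → ℝ)) →
      Integrable (fun ω => G.disc ^ n * φ (G.X n ω)) (G.P x) :=
    fun φ hm h => (G.integrable_X_of_mem hG x i hm h n).const_mul _
  have hXo : ∀ {φ : E → ℝ}, Measurable φ → Measurable[G.others (j, n)] fun ω => φ (G.X n ω) :=
    fun h => h.comp (G.measurable_X_others _ n)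
  set R : Ω → ℝ := fun ω => G.reward i (σ ω) (τ ω) (G.path ω) with hR
  have hRi : Integrable R (G.P x) := G.integrable_reward hG x i hσ.measurable hτA.measurable
  -- Where the game survives time `n`, the Markov property replaces the next value by its
  -- conditional mean `C (X n)`. What remains random at time `n` is the opponent's device.
  set Y : Ω → ℝ := fun ω =>
    if ω ∈ running σ τ (n + 1) then G.disc ^ (n + 1) * C (G.X n ω) else R ω with hY
  have hYi : Integrable Y (G.P x) :=
    Integrable.piecewise (f := fun ω => G.disc ^ (n + 1) * C (G.X n ω)) (g := R) hWm'
      (hCi.const_mul _).integrableOn hRi.integrableOn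
  have e₁ : ∫ ω in running σ τ n, Y ω ∂(G.P x) =
      ∫ ω in running σ τ n \ running σ τ (n + 1), R ω ∂(G.P x) +
        G.disc ^ (n + 1) * ∫ ω in running σ τ (n + 1), V i (G.X (n + 1) ω) ∂(G.P x) := by
    rw [G.setIntegral_X_succ x n hWp (hV i) (hVi (n + 1)), ← integral_const_mul,
      ← sdiff_union_of_subset hsub, setIntegral_union disjoint_sdiff_left hWm'
        hYi.integrableOn hYi.integrableOn, sdiff_union_of_subset hsub]
    congr 1
    · refine setIntegral_congr_fun (hWm.diff hWm') fun ω hω => ?_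
      exact if_neg hω.2
    · refine setIntegral_congr_fun hWm' fun ω hω => ?_
      exact if_pos hω
  rw [← e₁]
  have hq := fun ω => hp01 j (G.X n ω)
  -- While the game is still running at `n`, the opponent stops exactly at `n` if and only if the
  -- device at `n` triggers.
  have hS : ∀ ω ∈ running σ τ n, (G.ξ j n ω ≤ p j (G.X n ω) → τ ω = n) ∧
      (¬ G.ξ j n ω ≤ p j (G.X n ω) → (n : ℕ∞) < τ ω) := by
    intro ω hω
    refine ⟨fun h => le_antisymm ?_ hω.2, fun h => lt_of_le_of_ne hω.2 fun h' => h ?_⟩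
    · exact (thresholdTime_le_iff p j (G.path ω) (G.noise ω) n).2 ⟨n, le_rfl, h⟩
    · obtain ⟨k, hk, hk'⟩ := (thresholdTime_le_iff p j (G.path ω) (G.noise ω) n).1 h'.ge
      rcases hk.lt_or_eq with hk | rfl
      · exact absurd hk' (not_le.2
          ((le_thresholdTime_iff p j (G.path ω) (G.noise ω) n).1 hω.2 k hk))
      · exact hk'
  -- If `σ = n`, averaging the device weights `h` against `f`; in the complementary case `e₃` it
  -- weights `g` against discounted continuation.
  have e₂ : ∫ ω in running σ τ n ∩ {ω | σ ω = n}, Y ω ∂(G.P x) =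
      ∫ ω in running σ τ n ∩ {ω | σ ω = n}, G.disc ^ n * G.stopValue p i (G.X n ω) ∂(G.P x) := by
    have h := G.setIntegral_ite_ξ x (j, n) (hWo.inter hσo)
      ((hXo (G.measurable_h i)).const_mul (G.disc ^ n))
      ((hXo (G.measurable_f i)).const_mul (G.disc ^ n))
      (hmem _ (G.measurable_h i) (by simp)) (hmem _ (G.measurable_f i) (by simp)) (hXo (hp j)) hq
    refine Eq.trans (setIntegral_congr_fun (hWm.inter hσm) fun ω hω => ?_)
      (h.trans (setIntegral_congr_fun (hWm.inter hσm) fun ω _ => ?_))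
    · have hσω : σ ω = n := hω.2
      have hn : ω ∉ running σ τ (n + 1) := by
        rw [hW']
        exact fun h => h.1.ne' hσω
      simp only [hY, hR, if_neg hn]
      split_ifs with hξ
      · rw [hσω, (hS ω hω.1).1 hξ]
        exact G.reward_self i n _
      · rw [hσω]
        exact G.reward_of_lt i ((hS ω hω.1).2 hξ) _
    · simp only [stopValue, ← hj]
      ring
  have e₃ : ∫ ω in running σ τ n \ {ω | σ ω = n}, Y ω ∂(G.P x) =
      ∫ ω in running σ τ n \ {ω | σ ω = n}, G.disc ^ n * G.contValue p V i (G.X n ω) ∂(G.P x) := by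
    have h := G.setIntegral_ite_ξ x (j, n) (hWo.diff hσo)
      ((hXo (G.measurable_g i)).const_mul (G.disc ^ n))
      ((hXo hCm).const_mul (G.disc ^ (n + 1)))
      (hmem _ (G.measurable_g i) (by simp)) (hCi.const_mul _) (hXo (hp j)) hq
    refine Eq.trans (setIntegral_congr_fun (hWm.diff hσm) fun ω hω => ?_)
      (h.trans (setIntegral_congr_fun (hWm.diff hσm) fun ω _ => ?_))
    · have hσω : (n : ℕ∞) < σ ω := lt_of_le_of_ne hω.1.1 fun h => hω.2 h.symm
      simp only [hY, hR, hW', mem_inter_iff, mem_ofPred_eq, hσω, true_and]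
      split_ifs with h1 h2 h2
      · exact absurd ((hS ω hω.1).1 h2) h1.ne'
      · rfl
      · rw [(hS ω hω.1).1 h2]
        exact G.reward_of_gt i hσω _
      · exact absurd ((hS ω hω.1).2 h2) h1
    · simp only [contValue, hC, ← hj]
      ring
  have hsi : Integrable (fun ω => G.stopValue p i (G.X n ω)) (G.P x) :=
    G.integrable_stopValue_X hG hp hp01 i x n
  have hci : Integrable (fun ω => G.contValue p V i (G.X n ω)) (G.P x) :=
    G.integrable_contValue_X hG hp hp01 hV i x n (hVi (n + 1))
  have hZi : Integrable (fun ω => G.disc ^ n * (if σ ω = n then G.stopValue p i (G.X n ω)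
      else G.contValue p V i (G.X n ω))) (G.P x) :=
    (Integrable.piecewise (s := {ω | σ ω = n}) (f := fun ω => G.stopValue p i (G.X n ω))
      (g := fun ω => G.contValue p V i (G.X n ω)) hσm hsi.integrableOn
      hci.integrableOn).const_mul _
  rw [← integral_const_mul, ← integral_inter_add_sdiff hσm hYi.integrableOn,
    ← integral_inter_add_sdiff hσm hZi.integrableOn, e₂, e₃]
  congr 1
  · refine setIntegral_congr_fun (hWm.inter hσm) fun ω hω => ?_
    rw [if_pos (show σ ω = n from hω.2)]
  · refine setIntegral_congr_fun (hWm.diff hσm) fun ω hω => ?_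
    rw [if_neg (show ¬ σ ω = n from hω.2)]

theorem antitone_running {α : Type*} (σ τ : α → ℕ∞) : Antitone (running σ τ) := fun _ _ h _ hω =>
  ⟨(Nat.cast_le.2 h).trans hω.1, (Nat.cast_le.2 h).trans hω.2⟩

theorem measurableSet_running {σ τ : Ω → ℕ∞} (hσ : Measurable σ) (hτ : Measurable τ) (n : ℕ) :
    MeasurableSet (running σ τ n) :=
  MeasurableSet.inter (hσ (MeasurableSet.of_discrete (s := {t : ℕ∞ | (n : ℕ∞) ≤ t})))
    (hτ (MeasurableSet.of_discrete (s := {t : ℕ∞ | (n : ℕ∞) ≤ t})))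

/-- The reward is the sum of its parts on the events that the game ends at time `n`. -/
theorem hasSum_setIntegral_running (hG : G.RewardsIntegrable) (x : E) (i : Fin 2)
    {σ τ : Ω → ℕ∞} (hσ : Measurable σ) (hτ : Measurable τ) :
    HasSum (fun n => ∫ ω in running σ τ n \ running σ τ (n + 1),
      G.reward i (σ ω) (τ ω) (G.path ω) ∂(G.P x))
      (∫ ω, G.reward i (σ ω) (τ ω) (G.path ω) ∂(G.P x)) := by
  have hR := G.integrable_reward hG x i hσ hτ
  have h := hasSum_integral_iUnion (μ := G.P x)
    (s := fun n => running σ τ n \ running σ τ (n + 1))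
    (fun n => (measurableSet_running hσ hτ n).diff (measurableSet_running hσ hτ (n + 1)))
    (fun m n hmn => ?_) hR.integrableOn
  · rwa [setIntegral_eq_integral_of_forall_compl_eq_zero] at h
    intro ω hω
    -- Outside all the pieces the game never ends, both times are infinite and the reward is 0.
    have hall : ∀ n, ω ∈ running σ τ n := fun n => by
      induction n with
      | zero => exact ⟨by simp, by simp⟩
      | succ n ih =>
        by_contra hn
        exact hω (mem_iUnion.2 ⟨n, ih, hn⟩)
    rw [ENat.eq_top_iff_forall_ge.2 fun n => (hall n).1,
      ENat.eq_top_iff_forall_ge.2 fun n => (hall n).2, reward_top]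
  · refine Set.disjoint_left.2 fun ω h₁ h₂ => ?_
    rcases lt_or_gt_of_ne hmn with hlt | hlt
    · exact h₁.2 (antitone_running σ τ (Nat.succ_le_of_lt hlt) h₂.1)
    · exact h₂.2 (antitone_running σ τ (Nat.succ_le_of_lt hlt) h₁.1)

/-! ### Domination of the values, vanishing remainder and verification. -/

/-- Only the positive part of `V` is controlled along all times by assumption. The system gives `V ≥
stopValue`, which bounds the negative part by `|f| + |h|`. -/
theorem lintegral_killedVal_values_lt_top (hG : G.RewardsIntegrable) {p V : Fin 2 → E → ℝ}
    (hp01 : ∀ i x, p i x ∈ Icc (0 : ℝ) 1)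
    (hS : G.WaldBellmanSystem p V) (hVI : G.ValuesIntegrable V) (i : Fin 2) (x : E) :
    ∫⁻ ω, ⨆ n : ℕ, G.killedVal (fun y => ‖V i y‖ₑ) n ω ∂(G.P x) < ∞ := by
  have hVI' := (hVI i x).2
  simp_rw [ofReal_evalKilled] at hVI'
  have hb : ∀ y, ‖V i y‖ₑ ≤ ENNReal.ofReal (V i y) + ‖G.f i y‖ₑ + ‖G.h i y‖ₑ := fun y => by
    simp_rw [← ofReal_norm, Real.norm_eq_abs]
    rcases le_total 0 (V i y) with h | h
    · rw [abs_of_nonneg h]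
      exact le_self_add.trans le_self_add
    · rw [ENNReal.ofReal_of_nonpos h, zero_add, ← ENNReal.ofReal_add (abs_nonneg _) (abs_nonneg _)]
      refine ENNReal.ofReal_le_ofReal ?_
      rw [abs_of_nonpos h]
      have h1 : G.stopValue p i y ≤ V i y := by
        rw [(hS i y).1]
        exact le_max_right _ _
      rw [stopValue] at h1
      obtain ⟨h2, h3⟩ := hp01 i.rev y
      have h4 := mul_le_of_le_one_left (abs_nonneg (G.f i y)) (sub_le_self 1 h2)
      have h5 := mul_le_of_le_one_left (abs_nonneg (G.h i y)) h3
      have h6 := mul_le_mul_of_nonneg_left (neg_abs_le (G.f i y)) (sub_nonneg.2 h3)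
      have h7 := mul_le_mul_of_nonneg_left (neg_abs_le (G.h i y)) h2
      linarith
  have hm : ∀ {φ : E → ℝ≥0∞}, Measurable φ → Measurable fun ω => ⨆ n : ℕ, G.killedVal φ n ω :=
    fun h => Measurable.iSup fun n => G.measurable_killedVal h n
  refine lt_of_le_of_lt (lintegral_mono (g := fun ω =>
    (⨆ n : ℕ, G.killedVal (fun y => ENNReal.ofReal (V i y)) n ω) +
    (⨆ n : ℕ, G.killedVal (fun y => ‖G.f i y‖ₑ) n ω) +
    (⨆ n : ℕ, G.killedVal (fun y => ‖G.h i y‖ₑ) n ω)) fun ω => iSup_le fun n => ?_) ?_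
  · refine le_trans ?_ (add_le_add (add_le_add
      (le_iSup (fun n : ℕ => G.killedVal (fun y => ENNReal.ofReal (V i y)) n ω) n)
      (le_iSup (fun n : ℕ => G.killedVal (fun y => ‖G.f i y‖ₑ) n ω) n))
      (le_iSup (fun n : ℕ => G.killedVal (fun y => ‖G.h i y‖ₑ) n ω) n))
    by_cases h : (n : ℕ∞) ≤ G.lifetime ω
    · simpa [killedVal, h] using hb (G.X n ω)
    · simp [killedVal, h]
  · rw [lintegral_add_right _ (hm (G.measurable_h i).enorm),
      lintegral_add_right _ (hm (G.measurable_f i).enorm)]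
    exact ENNReal.add_lt_top.2 ⟨ENNReal.add_lt_top.2
      ⟨hVI', G.lintegral_killedVal_enorm_lt_top hG x i (by simp)⟩,
      G.lintegral_killedVal_enorm_lt_top hG x i (by simp)⟩

theorem tendsto_disc_mul_setIntegral (x : E) {φ : E → ℝ} (hφ : Measurable φ)
    (h : ∫⁻ ω, ⨆ n : ℕ, G.killedVal (fun y => ‖φ y‖ₑ) n ω ∂(G.P x) < ∞) (S : ℕ → Set Ω) :
    Tendsto (fun n : ℕ => G.disc ^ n * ∫ ω in S n, φ (G.X n ω) ∂(G.P x)) atTop (𝓝 0) := by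
  refine tendsto_zero_iff_enorm_tendsto_zero.2 ?_
  refine tendsto_of_tendsto_of_tendsto_of_le_of_le tendsto_const_nhds
    (G.tendsto_disc_mul_lintegral x hφ.enorm h) (fun _ => zero_le) fun n => ?_
  dsimp only
  rw [enorm_mul, Real.enorm_of_nonneg (pow_nonneg G.disc_pos.le n)]
  exact mul_le_mul_right ((enorm_integral_le_lintegral_enorm _).trans
    (setLIntegral_le_lintegral _ _)) _

theorem isGlobalEquilibrium_of_waldBellmanSystem (hG : G.RewardsIntegrable)
    {p V : Fin 2 → E → ℝ} (hp : ∀ i, Measurable (p i)) (hp01 : ∀ i x, p i x ∈ Icc (0 : ℝ) 1)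
    (hV : ∀ i, Measurable (V i)) (hS : G.WaldBellmanSystem p V) (hVI : G.ValuesIntegrable V) :
    G.IsGlobalEquilibrium p ∧ G.HasValues p V := by
  classical
  have hkill := G.lintegral_killedVal_values_lt_top hG hp01 hS hVI
  have hVi : ∀ i x n, Integrable (fun ω => V i (G.X n ω)) (G.P x) :=
    fun i x => G.integrable_X x (hV i) (hkill i x)
  have hJ : ∀ i x σ, G.J i x (Function.update (G.markovTime p) i σ) =
      ∫ ω, G.reward i (σ ω) (G.markovTime p i.rev ω) (G.path ω) ∂(G.P x) := fun i x σ =>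
    integral_congr_ae (ae_of_all _ fun ω => G.payoff_update i _ σ ω)
  -- The remainder: the discounted value carried by games still running at time `n`.
  set a : Fin 2 → E → (Ω → ℕ∞) → ℕ → ℝ := fun i x σ n =>
    G.disc ^ n * ∫ ω in running σ (G.markovTime p i.rev) n, V i (G.X n ω) ∂(G.P x) with ha
  have ha0 : ∀ i x σ, a i x σ 0 = V i x := fun i x σ => by
    have e : running σ (G.markovTime p i.rev) 0 = univ := by
      ext ω
      simp [running]
    simp only [ha, e, Measure.restrict_univ, pow_zero, one_mul]
    rw [integral_congr_ae (G.ae_X_zero x (hV i))]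
    simp
  have halim : ∀ i x σ, Tendsto (a i x σ) atTop (𝓝 0) := fun i x σ =>
    G.tendsto_disc_mul_setIntegral x (hV i) (hkill i x) _
  have hτm := fun i => (G.admissible_markovTime hp i).measurable
  have hstep := fun i x σ (hσ : G.Admissible i σ) n =>
    G.setIntegral_running_step hG hp hp01 hV i x (hVi i x) hσ n
  have hle : ∀ i x σ, G.Admissible i σ →
      G.J i x (Function.update (G.markovTime p) i σ) ≤ V i x := by
    intro i x σ hσ
    have hsum := (G.hasSum_setIntegral_running hG x i hσ.measurable (hτm i.rev)).tendsto_sum_nat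
    rw [← hJ] at hsum
    have hlim := hsum.add (halim i x σ)
    rw [add_zero] at hlim
    -- Every partial reward plus remainder is at most `V i x`: equality holds at `N = 0`, and each
    -- step can only decrease it.
    refine le_of_tendsto' hlim fun N => ?_
    induction N with
    | zero => simp [ha0]
    | succ N ih =>
      refine le_trans ?_ ih
      rw [Finset.sum_range_succ, add_assoc]
      refine add_le_add_right ?_ _
      refine (hstep i x σ hσ N).trans_le (mul_le_mul_of_nonneg_left ?_
        (pow_nonneg G.disc_pos.le N))
      have hσN : MeasurableSet {ω | σ ω = N} := hσ.measurable (measurableSet_singleton (N : ℕ∞))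
      refine setIntegral_mono (Integrable.piecewise (s := {ω | σ ω = N})
        (f := fun ω => G.stopValue p i (G.X N ω)) (g := fun ω => G.contValue p V i (G.X N ω)) hσN
        (G.integrable_stopValue_X hG hp hp01 i x N).integrableOn
        (G.integrable_contValue_X hG hp hp01 hV i x N (hVi i x _)).integrableOn).integrableOn
        (hVi i x N).integrableOn fun ω => ?_
      dsimp only
      rw [(hS i (G.X N ω)).1]
      split_ifs
      exacts [le_max_right _ _, le_max_left _ _]
  have heq : G.HasValues p V := by
    intro i x
    have hsum := (G.hasSum_setIntegral_running hG x i (hτm i) (hτm i.rev)).tendsto_sum_nat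
    rw [← hJ, Function.update_eq_self] at hsum
    have hlim := hsum.add (halim i x (G.markovTime p i))
    rw [add_zero] at hlim
    refine tendsto_nhds_unique (tendsto_const_nhds.congr fun N => ?_) hlim
    induction N with
    | zero => simp [ha0]
    | succ N ih =>
      rw [ih, Finset.sum_range_succ, add_assoc]
      congr 1
      refine Eq.symm ((hstep i x _ (G.admissible_markovTime hp i) N).trans ?_)
      congr 1
      refine setIntegral_congr_ae (measurableSet_running (hτm i) (hτm i.rev) N) ?_
      -- Devices lie strictly between 0 and 1 almost surely. Stopping at `N` therefore forces `p >
      -- 0` and continuing forces `p < 1`, so the action taken always attains the maximum.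
      filter_upwards [G.ae_ξ_mem x i N] with ω hξ hω
      obtain ⟨h1, h2, h3⟩ := hS i (G.X N ω)
      split_ifs with hN
      · have hpos : 0 < p i (G.X N ω) := by
          obtain ⟨k, hk, hk'⟩ :=
            (thresholdTime_le_iff p i (G.path ω) (G.noise ω) N).1 hN.le
          rcases hk.lt_or_eq with hk | rfl
          · exact absurd hk' (not_le.2
              ((le_thresholdTime_iff p i (G.path ω) (G.noise ω) N).1 hω.1 k hk))
          · exact hξ.1.trans_le hk'
        rw [h1, max_eq_right (h2 hpos)]
      · have hlt : p i (G.X N ω) < 1 :=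
          ((lt_thresholdTime_iff p i (G.path ω) (G.noise ω) N).1
            (lt_of_le_of_ne hω.1 fun h => hN h.symm) N le_rfl).trans hξ.2
        rw [h1, max_eq_left (h3 hlt)]
  refine ⟨fun x => ⟨G.admissible_markovTime hp, fun i => ⟨?_, fun b hb => ?_⟩⟩, heq⟩
  · rintro _ ⟨σ, hσ, rfl⟩
    rw [← heq i x]
    exact hle i x σ hσ
  · refine hb ⟨G.markovTime p i, G.admissible_markovTime hp i, ?_⟩
    rw [Function.update_eq_self]

end MarkovDynkinGame

end

theorem mainTheorem2 {E Ω : Type*} [MeasurableSpace E] [MeasurableSpace Ω]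
    (G : MarkovDynkinGame E Ω) (hG : G.RewardsIntegrable)
    (p V : Fin 2 → E → ℝ)
    (hp : ∀ i, Measurable (p i)) (hp01 : ∀ i x, p i x ∈ Set.Icc (0 : ℝ) 1)
    (hV : ∀ i, Measurable (V i)) :
    (G.IsGlobalEquilibrium p ∧ G.HasValues p V →
      (∀ i x, Integrable (V i) (G.kern x)) ∧ G.WaldBellmanSystem p V) ∧
    (G.WaldBellmanSystem p V ∧ G.ValuesIntegrable V →
      G.IsGlobalEquilibrium p ∧ G.HasValues p V) :=
  ⟨fun h => ⟨fun i x => (G.J_update_delayedTime hG hp hp01 h.2 i x).1,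
    G.waldBellmanSystem_of_isGlobalEquilibrium hG hp hp01 h.1 h.2⟩,
    fun h => G.isGlobalEquilibrium_of_waldBellmanSystem hG hp hp01 hV h.1 h.2⟩
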